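/- Let $\xi>0$. Consider the spin-$1/2$ chain on $\mathbb{Z}$ with nearest-neighbour interaction $$ h(n,n+1) = -\operatorname{sech}(\xi)\, \boldsymbol{S}_n\cdot\boldsymbol{S}_{n+1} - (1-\operatorname{sech}\xi)\, S^3_nS^3_{n+1} + \tfrac12\tanh(\xi)\,(S^3_n-S^3_{n+1}), $$ where $\boldsymbol{S}_n=(S^1_n,S^2_n,S^3_n)$ are the spin-$1/2$ matrices at site $n$. For finite $\Lambda\subset\mathbb{Z}$ let $H_\Lambda=\sum_{n,n+1\in\Lambda}h(n,n+1)$ act on $\mathcal{H}_\Lambda=\bigotimes_{n\in\Lambda}\mathbb{C}^2$ and let $\mathcal{A}_\Lambda=\mathcal{B}(\mathcal{H}_\Lambda)$. Let $\mathcal{A}$ be the quasilocal algebra, i.e. the $C^*$-algebra that is the norm closure of $\bigcup_\Lambda\mathcal{A}_\Lambda$, and for local $X$ (that is, $X\in\mathcal{A}_\Lambda$ with $\Lambda$ finite) let $\delta(X)=\lim_{\Lambda'\nearrow\mathbb{Z}}[H_{\Lambda'},X]$. A state $\omega$ on $\mathcal{A}$ is an infinite-volume ground state if $\omega(X^*\delta(X))\ge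 0$ for all local $X$; its spectral gap is the greatest number $\gamma$ such that $$ \omega(\delta(X)^*\delta^2(X))\ \ge\ \gamma\,\omega(\delta(X)^*\delta(X))\qquad\text{for all local } X . $$ Let $\Lambda_i=[a_i,b_i]\subset\mathbb{Z}$ be a sequence (or net) of finite intervals with $a_i\to-\infty$ and $b_i\to+\infty$, and for each $i$ let $\psi_i\in\mathcal{H}_{\Lambda_i}$ be a unit vector that is an eigenvector of $H_{\Lambda_i}$ for its lowest eigenvalue (a finite-volume kink ground state). Let $\omega$ be a state on $\mathcal{A}$ that is the weak-$*$ limit of the states $\langle\psi_i,\,\cdot\,\psi_i\rangle$, i.e. $\omega(X)=\lim_i\langle\psi_i,X\psi_i\rangle$ for every local $X$. Then $\omega$ is an infinite-volume ground state, and its spectral gap is exactly $1-\operatorname{sech}\xi$. -/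

import Mathlib

namespace XXZ

open Filter Topology
open scoped ComplexOrder

/-! ### Finite volume

The basis state `0 : Fin 2` is spin up and `1 : Fin 2` is spin down.  For a finite `Λ ⊆ ℤ` the space
`⨂_{x ∈ Λ} ℂ²` is identified with `EuclideanSpace ℂ (Λ → Fin 2)` through its orthonormal basis of
spin configurations, and `B(⨂_{x ∈ Λ} ℂ²)` with the matrices indexed by configurations. -/

/-- The observables localized in the finite set `Λ`. -/
abbrev LocalMatrix (Λ : Finset ℤ) : Type := Matrix (Λ → Fin 2) (Λ → Fin 2) ℂ

/-- The Hilbert space of the finite volume `Λ`. -/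
abbrev LocalSpace (Λ : Finset ℤ) : Type := EuclideanSpace ℂ (Λ → Fin 2)

/-- The one-site spin-1/2 matrix `S¹`. -/
noncomputable def S1 : Matrix (Fin 2) (Fin 2) ℂ := !![0, 1 / 2; 1 / 2, 0]

/-- The matrix `S²`. -/
noncomputable def S2 : Matrix (Fin 2) (Fin 2) ℂ := !![0, -Complex.I / 2; Complex.I / 2, 0]

/-- The matrix `S³`. -/
noncomputable def S3 : Matrix (Fin 2) (Fin 2) ℂ := !![1 / 2, 0; 0, -1 / 2]

/-- The one-site matrix `M` acting at the site `x`, tensored with the identity elsewhere. -/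
noncomputable def atSite {Λ : Finset ℤ} (x : Λ) (M : Matrix (Fin 2) (Fin 2) ℂ) : LocalMatrix Λ :=
  fun ρ τ => if ∀ y, y ≠ x → ρ y = τ y then M (ρ x) (τ x) else 0

/-- The two-site interaction
`- sech ξ 𝐒ₓ·𝐒_y - (1 - sech ξ) S³ₓ S³_y + (1/2) tanh ξ (S³ₓ - S³_y)`. -/
noncomputable def interaction (ξ : ℝ) {Λ : Finset ℤ} (x y : Λ) : LocalMatrix Λ :=
  -((1 / Real.cosh ξ : ℝ) : ℂ) •
      (atSite x S1 * atSite y S1 + atSite x S2 * atSite y S2 + atSite x S3 * atSite y S3)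
    - ((1 - 1 / Real.cosh ξ : ℝ) : ℂ) • (atSite x S3 * atSite y S3)
    + ((1 / 2 * Real.tanh ξ : ℝ) : ℂ) • (atSite x S3 - atSite y S3)

/-- The Hamiltonian of the finite volume `Λ`: the sum of the interactions of all nearest-neighbour
pairs `x, x + 1` in `Λ`. -/
noncomputable def hamiltonian (ξ : ℝ) (Λ : Finset ℤ) : LocalMatrix Λ :=
  ∑ x : Λ, if hx : (x : ℤ) + 1 ∈ Λ then interaction ξ x ⟨(x : ℤ) + 1, hx⟩ else 0

/-- `ψ` is a normalized ground state vector of the finite volume `Λ`: an eigenvector of the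
Hamiltonian whose eigenvalue is the minimal energy. -/
def IsGroundVector (ξ : ℝ) (Λ : Finset ℤ) (ψ : LocalSpace Λ) : Prop :=
  ‖ψ‖ = 1 ∧ ∃ E : ℝ, Matrix.toEuclideanLin (hamiltonian ξ Λ) ψ = (E : ℂ) • ψ ∧
    ∀ φ : LocalSpace Λ,
      E * ‖φ‖ ^ 2 ≤ (inner ℂ φ (Matrix.toEuclideanLin (hamiltonian ξ Λ) φ)).re

/-- The restriction of a configuration to a smaller set. -/
def restrict {Λ Λ' : Finset ℤ} (h : Λ ⊆ Λ') (ρ : Λ' → Fin 2) : Λ → Fin 2 :=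
  fun x => ρ ⟨x, h x.2⟩

/-- The inclusion of the observables of `Λ` in those of `Λ' ⊇ Λ`, by tensoring with the identity
on `Λ' \ Λ`. -/
noncomputable def extend {Λ Λ' : Finset ℤ} (h : Λ ⊆ Λ') (A : LocalMatrix Λ) : LocalMatrix Λ' :=
  fun ρ τ => if ∀ y : Λ', (y : ℤ) ∉ Λ → ρ y = τ y then A (restrict h ρ) (restrict h τ) else 0

/-- The expectation `⟨ψ, A ψ⟩` of the observable `A` of `Λ` in the vector `ψ` of the volume `Λ'`,
where `Λ ⊆ Λ'` (and `0` if `Λ` is not contained in `Λ'`). -/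
noncomputable def expectation {Λ' : Finset ℤ} (ψ : LocalSpace Λ') {Λ : Finset ℤ}
    (A : LocalMatrix Λ) : ℂ :=
  if h : Λ ⊆ Λ' then inner ℂ ψ (Matrix.toEuclideanLin (extend h A) ψ) else 0

/-! ### The quasilocal algebra

The algebras of local observables are represented faithfully and compatibly by operators on
`ℓ²({↑, ↓}^ℤ)`, a local observable acting on the spins of its finite set only.  The quasilocal
algebra is the C*-algebra that they generate there. -/

/-- The space `ℓ²` over all spin configurations on `ℤ`. -/
abbrev ConfigSpace : Type := lp (fun _ : ℤ → Fin 2 => ℂ) 2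

/-- The configuration that is `τ` on `Λ` and `σ` elsewhere. -/
def overwrite {Λ : Finset ℤ} (τ : Λ → Fin 2) (σ : ℤ → Fin 2) : ℤ → Fin 2 :=
  fun x => if h : x ∈ Λ then τ ⟨x, h⟩ else σ x

/-- The coordinates of the matrix unit `|ρ⟩⟨τ|` of `Λ` applied to a vector. -/
def matrixUnitFun {Λ : Finset ℤ} (ρ τ : Λ → Fin 2) (ψ : (ℤ → Fin 2) → ℂ) (σ : ℤ → Fin 2) : ℂ :=
  if (fun x : Λ => σ x) = ρ then ψ (overwrite τ σ) else 0

theorem sum_matrixUnitFun_le {Λ : Finset ℤ} (ρ τ : Λ → Fin 2) (ψ : ConfigSpace)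
    (s : Finset (ℤ → Fin 2)) :
    ∑ σ ∈ s, ‖matrixUnitFun ρ τ ψ σ‖ ^ (2 : ENNReal).toReal ≤ ‖ψ‖ ^ (2 : ENNReal).toReal := by
  classical
  set t := s.filter (fun σ => (fun x : Λ => σ x) = ρ) with ht
  have hinj : Set.InjOn (overwrite τ) (t : Set (ℤ → Fin 2)) := by
    intro σ hσ σ' hσ' h
    simp only [ht, Finset.coe_filter, Set.mem_ofPred_eq] at hσ hσ'
    funext x
    by_cases hx : x ∈ Λ
    · exact (congrFun hσ.2 ⟨x, hx⟩).trans (congrFun hσ'.2 ⟨x, hx⟩).symm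
    · simpa [overwrite, hx] using congrFun h x
  calc ∑ σ ∈ s, ‖matrixUnitFun ρ τ ψ σ‖ ^ (2 : ENNReal).toReal
      = ∑ σ ∈ t, ‖ψ (overwrite τ σ)‖ ^ (2 : ENNReal).toReal := by
        rw [ht, Finset.sum_filter]
        refine Finset.sum_congr rfl fun σ _ => ?_
        unfold matrixUnitFun
        split_ifs <;> simp
    _ = ∑ σ ∈ t.image (overwrite τ), ‖ψ σ‖ ^ (2 : ENNReal).toReal :=
        (Finset.sum_image (f := fun σ => ‖ψ σ‖ ^ (2 : ENNReal).toReal) hinj).symm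
    _ ≤ ‖ψ‖ ^ (2 : ENNReal).toReal := lp.sum_rpow_le_norm_rpow (by simp) ψ _

/-- The matrix unit `|ρ⟩⟨τ|` of `Λ`, tensored with the identity on the complement of `Λ`. -/
noncomputable def matrixUnit {Λ : Finset ℤ} (ρ τ : Λ → Fin 2) : ConfigSpace →L[ℂ] ConfigSpace :=
  LinearMap.mkContinuous
    { toFun := fun ψ => ⟨matrixUnitFun ρ τ ψ, memℓp_gen' (sum_matrixUnitFun_le ρ τ ψ)⟩
      map_add' := fun ψ φ => by
        ext σ
        change matrixUnitFun ρ τ _ σ = matrixUnitFun ρ τ _ σ + matrixUnitFun ρ τ _ σ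
        unfold matrixUnitFun
        split_ifs <;> simp
      map_smul' := fun c ψ => by
        ext σ
        change matrixUnitFun ρ τ _ σ = c • matrixUnitFun ρ τ _ σ
        unfold matrixUnitFun
        split_ifs <;> simp }
    1 (fun ψ => by
      rw [one_mul]
      exact lp.norm_le_of_forall_sum_le (by simp) (norm_nonneg _) (sum_matrixUnitFun_le ρ τ ψ))

/-- The local observable `A` of `Λ` as an operator on `ℓ²({↑, ↓}^ℤ)`. -/
noncomputable def localOp (Λ : Finset ℤ) (A : LocalMatrix Λ) : ConfigSpace →L[ℂ] ConfigSpace :=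
  ∑ ρ : Λ → Fin 2, ∑ τ : Λ → Fin 2, A ρ τ • matrixUnit ρ τ

/-- The quasilocal observable algebra: the norm closure of the algebra of local observables. -/
noncomputable def quasilocal : StarSubalgebra ℂ (ConfigSpace →L[ℂ] ConfigSpace) :=
  (StarAlgebra.adjoin ℂ (⋃ Λ : Finset ℤ, Set.range (localOp Λ))).topologicalClosure

/-- A local observable as an element of the quasilocal algebra. -/
noncomputable def localObs (Λ : Finset ℤ) (A : LocalMatrix Λ) : quasilocal :=
  ⟨localOp Λ A, StarSubalgebra.le_topologicalClosure _
    (StarAlgebra.subset_adjoin ℂ _ (Set.mem_iUnion.2 ⟨Λ, A, rfl⟩))⟩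

/-- A state: a positive linear functional with `ω 1 = 1`. -/
def IsState (ω : quasilocal →ₗ[ℂ] ℂ) : Prop :=
  (∀ X : quasilocal, 0 ≤ ω (star X * X)) ∧ ω 1 = 1

/-- The derivation `δ(X) = lim_{Λ ↗ ℤ} [H_Λ, X]`.  On local `X` the net of commutators is
eventually constant, and `δ(X)` is again local. -/
noncomputable def derivation (ξ : ℝ) (X : quasilocal) : quasilocal :=
  limUnder atTop fun Λ : Finset ℤ =>
    localObs Λ (hamiltonian ξ Λ) * X - X * localObs Λ (hamiltonian ξ Λ)

/-- `ω` is an infinite volume ground state: `ω(X* δ(X)) ≥ 0` for every local `X`. -/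
def IsGroundState (ξ : ℝ) (ω : quasilocal →ₗ[ℂ] ℂ) : Prop :=
  IsState ω ∧ ∀ (Λ : Finset ℤ) (A : LocalMatrix Λ),
    0 ≤ ω (star (localObs Λ A) * derivation ξ (localObs Λ A))

/-- The numbers `γ` with `ω(δ(X)* δ²(X)) ≥ γ ω(δ(X)* δ(X))` for every local `X`.  (The inequality
in `ℂ` includes that the two sides have the same imaginary part.) -/
def gapBounds (ξ : ℝ) (ω : quasilocal →ₗ[ℂ] ℂ) : Set ℝ :=
  {γ | ∀ (Λ : Finset ℤ) (A : LocalMatrix Λ),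
    (γ : ℂ) * ω (star (derivation ξ (localObs Λ A)) * derivation ξ (localObs Λ A)) ≤
      ω (star (derivation ξ (localObs Λ A)) * derivation ξ (derivation ξ (localObs Λ A)))}

/-- `γ` is the spectral gap above `ω`: the greatest number in `gapBounds ξ ω`. -/
def IsSpectralGap (ξ : ℝ) (ω : quasilocal →ₗ[ℂ] ℂ) (γ : ℝ) : Prop :=
  IsGreatest (gapBounds ξ ω) γ

/-- `ω` is the weak-* limit along `l` of the vector states `⟨ψᵢ, · ψᵢ⟩` of finite volumes `Vᵢ`:
the expectations of every local observable converge. -/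
def IsWeakStarLimit {ι : Type*} (l : Filter ι) (V : ι → Finset ℤ) (ψ : ∀ i, LocalSpace (V i))
    (ω : quasilocal →ₗ[ℂ] ℂ) : Prop :=
  ∀ (Λ : Finset ℤ) (A : LocalMatrix Λ),
    Tendsto (fun i => expectation (ψ i) A) l (𝓝 (ω (localObs Λ A)))

end XXZ

/-!
Up to constants the interactions are projections `P n` with `P n * P (n ± 1) * P n = c² • P n` and
`c = (1 / 2) sech ξ`, and the chain is frustration-free: all of them annihilate the ground states
of the finite volumes. These Temperley–Lieb relations give `(1 - 2 * c) • T ≤ T ^ 2` for the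
Hamiltonian `T` of every finite volume in the GNS representation of the limit state, which is the
lower bound on the gap. Conversely, the probability of a domain wall at `n` vanishes as `n → ∞`.
There, a spin flip hops like a free particle, so that a sum of `N` adjacent spin flips is, up to
boundary terms, an eigenvector of energy `1 - 2 * c`.
-/

namespace XXZ

open Filter Topology
open scoped ComplexOrder InnerProductSpace

/-! ### The Pauli algebra of the chain -/

section Bond

variable {R : Type*} [Ring R] [Algebra ℂ R]

/-- The projection `(1 + U) / 2` onto the fixed vectors of a reflection `U`, that is, of a
self-adjoint involution. -/
noncomputable def fixedProj (U : R) : R := (1 / 2 : ℂ) • (1 + U)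

/-- The projection onto the configurations with a domain wall between `n` and `n + 1`, where `Z x`
is the Pauli matrix `σ³` at `x`. -/
noncomputable def wall (Z : ℤ → R) (n : ℤ) : R := fixedProj (-(Z n * Z (n + 1)))

/-- The reflection which the interaction of `n` and `n + 1` induces on the configurations with a
domain wall between these sites; `Z x` and `X x` are the Pauli matrices `σ³` and `σ¹` at `x`. -/
noncomputable def bondReflection (t c : ℝ) (Z X : ℤ → R) (n : ℤ) : R :=
  (t : ℂ) • Z n - (2 * c : ℂ) • (X n * X (n + 1))

/-- The interaction of `n` and `n + 1`, shifted by a constant to have ground state energy zero.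
The parameters of the kink chain are `t = tanh ξ` and `c = (1 / 2) sech ξ`. -/
noncomputable def bond (t c : ℝ) (Z X : ℤ → R) (n : ℤ) : R :=
  fixedProj (bondReflection t c Z X n) * wall Z n

/-- The Hamiltonian of the sites `p, …, q`: the sum of the terms `P n` over `p ≤ n < q`. -/
noncomputable def chainSum {M : Type*} [AddCommMonoid M] (P : ℤ → M) (p q : ℤ) : M :=
  ∑ n ∈ Finset.Ico p q, P n

variable {t c : ℝ} {Z X : ℤ → R}

theorem isStarProjection_fixedProj [StarRing R] [StarModule ℂ R] {U : R} (hU : IsSelfAdjoint U)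
    (hU' : U * U = 1) : IsStarProjection (fixedProj U) where
  isIdempotentElem := by
    simp only [IsIdempotentElem, fixedProj, smul_mul_smul_comm, mul_add, add_mul, one_mul, mul_one,
      hU']
    module
  isSelfAdjoint := by simp [IsSelfAdjoint, fixedProj, hU.star_eq]

theorem commute_fixedProj {A U : R} (h : Commute A U) : Commute A (fixedProj U) :=
  ((Commute.one_right A).add_right h).smul_right _

theorem mul_fixedProj_of_anticommute {A U : R} (h : A * U = -(U * A)) :
    A * fixedProj U = (1 - fixedProj U) * A := by
  simp only [fixedProj, mul_smul_comm, smul_mul_assoc, sub_mul, one_mul, mul_add, add_mul, mul_one,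
    h]
  module

theorem bond_commute {A : R} {n : ℤ} (h1 : Commute (Z n) A) (h2 : Commute (Z (n + 1)) A)
    (h3 : Commute (X n) A) (h4 : Commute (X (n + 1)) A) : Commute (bond t c Z X n) A := by
  refine .symm (.mul_right (commute_fixedProj ?_) (commute_fixedProj ?_))
  · exact (h1.symm.smul_right _).sub_right ((h3.symm.mul_right h4.symm).smul_right _)
  · exact (h1.symm.mul_right h2.symm).neg_right

theorem map_bond {S : Type*} [Ring S] [Algebra ℂ S] (f : R →ₐ[ℂ] S) (n : ℤ) :
    f (bond t c Z X n) = bond t c (fun x => f (Z x)) (fun x => f (X x)) n := by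
  simp only [bond, wall, bondReflection, fixedProj, map_mul, map_add, map_one, map_sub, map_smul,
    map_neg]

end Bond

/-- The relations between the Pauli matrices `Z x = σ³ₓ` and `X x = σ¹ₓ` of a chain. -/
structure IsPauli {R : Type*} [Ring R] [StarRing R] (Z X : ℤ → R) : Prop where
  Z_sq : ∀ x, Z x * Z x = 1
  X_sq : ∀ x, X x * X x = 1
  anticomm : ∀ x, X x * Z x = -(Z x * X x)
  Z_comm : ∀ x y, Commute (Z x) (Z y)
  X_comm : ∀ x y, Commute (X x) (X y)
  X_Z_comm : ∀ x y, x ≠ y → Commute (X x) (Z y)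
  star_Z : ∀ x, IsSelfAdjoint (Z x)
  star_X : ∀ x, IsSelfAdjoint (X x)

namespace IsPauli

section Relations

variable {R : Type*} [Ring R] [StarRing R] {Z X : ℤ → R} (h : IsPauli Z X)
include h

theorem map {S F : Type*} [Ring S] [StarRing S] [FunLike F R S] [RingHomClass F R S]
    [StarHomClass F R S] (f : F) : IsPauli (fun x => f (Z x)) (fun x => f (X x)) where
  Z_sq x := by rw [← map_mul, h.Z_sq, map_one]
  X_sq x := by rw [← map_mul, h.X_sq, map_one]
  anticomm x := by rw [← map_mul, ← map_mul, h.anticomm, map_neg]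
  Z_comm x y := (h.Z_comm x y).map f
  X_comm x y := (h.X_comm x y).map f
  X_Z_comm x y hxy := (h.X_Z_comm x y hxy).map f
  star_Z x := (h.star_Z x).map f
  star_X x := (h.star_X x).map f

theorem X_mul_X_anticommute_Z (n : ℤ) :
    X n * X (n + 1) * Z n = -(Z n * (X n * X (n + 1))) := by
  rw [mul_assoc, (h.X_Z_comm (n + 1) n (by omega)).eq, ← mul_assoc, h.anticomm, neg_mul, mul_assoc]

theorem X_mul_X_sq (n : ℤ) : X n * X (n + 1) * (X n * X (n + 1)) = 1 := by
  rw [(h.X_comm (n + 1) n).mul_mul_mul_comm, h.X_sq, h.X_sq, one_mul]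

variable [Algebra ℂ R]

theorem Z_commute_wall (x n : ℤ) : Commute (Z x) (wall Z n) :=
  commute_fixedProj ((h.Z_comm x n).mul_right (h.Z_comm x (n + 1))).neg_right

theorem X_commute_wall {x n : ℤ} (h1 : x ≠ n) (h2 : x ≠ n + 1) : Commute (X x) (wall Z n) :=
  commute_fixedProj ((h.X_Z_comm x n h1).mul_right (h.X_Z_comm x (n + 1) h2)).neg_right

theorem X_mul_wall (n : ℤ) : X n * wall Z n = (1 - wall Z n) * X n := by
  refine mul_fixedProj_of_anticommute ?_
  rw [mul_neg, ← mul_assoc, h.anticomm, neg_mul, mul_assoc, (h.X_Z_comm n (n + 1) (by omega)).eq,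
    ← mul_assoc, neg_mul]

theorem X_succ_mul_wall (n : ℤ) : X (n + 1) * wall Z n = (1 - wall Z n) * X (n + 1) := by
  refine mul_fixedProj_of_anticommute ?_
  rw [mul_neg, ← mul_assoc, (h.X_Z_comm (n + 1) n (by omega)).eq, mul_assoc, h.anticomm, mul_neg,
    ← mul_assoc, neg_mul]

theorem Z_mul_wall (n : ℤ) : Z n * wall Z n = (1 / 2 : ℂ) • (Z n - Z (n + 1)) := by
  rw [wall, fixedProj, mul_smul_comm, mul_add, mul_one, mul_neg, ← mul_assoc, h.Z_sq, one_mul,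
    sub_eq_add_neg]

theorem Z_succ_mul_wall (n : ℤ) : Z (n + 1) * wall Z n = -(Z n * wall Z n) := by
  rw [h.Z_mul_wall, wall, fixedProj, mul_smul_comm, mul_add, mul_one, mul_neg, (h.Z_comm n _).eq,
    ← mul_assoc, h.Z_sq, one_mul]
  module

variable {t c : ℝ}

theorem bondReflection_mul_self (htc : t ^ 2 + 4 * c ^ 2 = 1) (n : ℤ) :
    bondReflection t c Z X n * bondReflection t c Z X n = 1 := by
  have htc' : (t : ℂ) ^ 2 + 4 * (c : ℂ) ^ 2 = 1 := by exact_mod_cast htc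
  simp only [bondReflection, sub_mul, mul_sub, smul_mul_smul_comm, h.X_mul_X_anticommute_Z,
    h.X_mul_X_sq, h.Z_sq]
  linear_combination (norm := module) htc' • (1 : R)

theorem wall_commute_bondReflection (n : ℤ) : Commute (wall Z n) (bondReflection t c Z X n) := by
  have hX : Commute (X n * X (n + 1)) (wall Z n) := by
    rw [Commute, SemiconjBy, mul_assoc, h.X_succ_mul_wall, ← mul_assoc, mul_sub, mul_one,
      h.X_mul_wall]
    noncomm_ring
  exact ((h.Z_commute_wall n n).symm.smul_right _).sub_right (hX.symm.smul_right _)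

theorem fixedProj_bondReflection_mul_Z_add (n : ℤ) :
    fixedProj (bondReflection t c Z X n) * Z n + Z n * fixedProj (bondReflection t c Z X n) =
      Z n + (t : ℂ) • 1 := by
  simp only [fixedProj, bondReflection, smul_mul_assoc, mul_smul_comm, add_mul, mul_add, sub_mul,
    mul_sub, one_mul, mul_one, h.X_mul_X_anticommute_Z, h.Z_sq]
  module

theorem bond_mul_Z_add (n : ℤ) :
    bond t c Z X n * Z n + Z n * bond t c Z X n = Z n * wall Z n + (t : ℂ) • wall Z n := by
  rw [bond, mul_assoc, ← (h.Z_commute_wall n n).eq, ← mul_assoc, ← mul_assoc, ← add_mul,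
    h.fixedProj_bondReflection_mul_Z_add, add_mul, smul_one_mul]

theorem bond_eq (n : ℤ) :
    bond t c Z X n = (1 / 4 : ℂ) • (1 - Z n * Z (n + 1)) + (t / 4 : ℂ) • (Z n - Z (n + 1))
      - (c : ℂ) • (X n * X (n + 1) * wall Z n) := by
  simp only [bond, fixedProj, bondReflection, smul_mul_assoc, add_mul, sub_mul, one_mul,
    h.Z_mul_wall]
  rw [wall, fixedProj]
  module

theorem bond_commute_X {x n : ℤ} (h1 : x ≠ n) (h2 : x ≠ n + 1) :
    Commute (bond t c Z X n) (X x) :=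
  bond_commute (h.X_Z_comm x n h1).symm (h.X_Z_comm x (n + 1) h2).symm (h.X_comm _ _)
    (h.X_comm _ _)

theorem bond_commute_Z {x n : ℤ} (h1 : x ≠ n) (h2 : x ≠ n + 1) :
    Commute (bond t c Z X n) (Z x) :=
  bond_commute (h.Z_comm _ _) (h.Z_comm _ _) (h.X_Z_comm n x h1.symm)
    (h.X_Z_comm (n + 1) x h2.symm)

theorem bond_commute_bond {m n : ℤ} (hmn : m + 1 < n) :
    Commute (bond t c Z X m) (bond t c Z X n) :=
  bond_commute (h.bond_commute_Z (by omega) (by omega)).symm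
    (h.bond_commute_Z (by omega) (by omega)).symm (h.bond_commute_X (by omega) (by omega)).symm
    (h.bond_commute_X (by omega) (by omega)).symm

theorem bond_mul_X (n : ℤ) :
    bond t c Z X n * X n = fixedProj (bondReflection t c Z X n) * X n
      - fixedProj (bondReflection t c Z X n) * X n * wall Z n := by
  rw [mul_assoc _ (X n), h.X_mul_wall, bond]
  noncomm_ring

theorem bond_mul_X_succ (n : ℤ) :
    bond t c Z X n * X (n + 1) = fixedProj (bondReflection t c Z X n) * X (n + 1)
      - fixedProj (bondReflection t c Z X n) * X (n + 1) * wall Z n := by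
  rw [mul_assoc _ (X (n + 1)), h.X_succ_mul_wall, bond]
  noncomm_ring

theorem fixedProj_bondReflection_add_mul_X (n : ℤ) :
    (fixedProj (bondReflection t c Z X n) + fixedProj (bondReflection t c Z X (n + 1))) *
        X (n + 1) =
      X (n + 1) - (c : ℂ) • X n - (c : ℂ) • X (n + 1 + 1)
        + (t : ℂ) • (X (n + 1) * (Z n * wall Z n)) := by
  have hZ : Z (n + 1) * X (n + 1) = -(X (n + 1) * Z (n + 1)) := by rw [h.anticomm, neg_neg]
  have hX : X n * X (n + 1) * X (n + 1) = X n := by rw [mul_assoc, h.X_sq, mul_one]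
  have hX' : X (n + 1) * X (n + 1 + 1) * X (n + 1) = X (n + 1 + 1) := by
    rw [(h.X_comm _ _).eq, mul_assoc, h.X_sq, mul_one]
  simp only [fixedProj, bondReflection, smul_mul_assoc, add_mul, sub_mul, one_mul, h.Z_mul_wall,
    mul_smul_comm, mul_sub, hZ, hX, hX', ← (h.X_Z_comm (n + 1) n (by omega)).eq]
  module

end Relations

section Projections

variable {R : Type*} [Ring R] [StarRing R] [Algebra ℂ R] [StarModule ℂ R] {Z X : ℤ → R}
  (h : IsPauli Z X) {t c : ℝ}
include h

theorem isStarProjection_wall (n : ℤ) : IsStarProjection (wall Z n) := by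
  refine isStarProjection_fixedProj ?_ ?_
  · exact ((IsSelfAdjoint.commute_iff (h.star_Z n) (h.star_Z (n + 1))).1 (h.Z_comm _ _)).neg
  · rw [neg_mul_neg, (h.Z_comm (n + 1) n).mul_mul_mul_comm, h.Z_sq, h.Z_sq, one_mul]

theorem wall_mul_bond (n : ℤ) : wall Z n * bond t c Z X n = bond t c Z X n := by
  rw [bond, ← mul_assoc, (commute_fixedProj (h.wall_commute_bondReflection n)).eq, mul_assoc,
    (h.isStarProjection_wall n).isIdempotentElem.eq]

theorem bond_mul_wall (n : ℤ) : bond t c Z X n * wall Z n = bond t c Z X n := by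
  rw [bond, mul_assoc, (h.isStarProjection_wall n).isIdempotentElem.eq]

theorem bond_mul_mul_bond_eq_zero {A : R} {n : ℤ} (hA : A * wall Z n = (1 - wall Z n) * A) :
    bond t c Z X n * A * bond t c Z X n = 0 :=
  calc bond t c Z X n * A * bond t c Z X n
      = bond t c Z X n * wall Z n * (A * wall Z n) * bond t c Z X n := by
        rw [h.bond_mul_wall, ← mul_assoc, mul_assoc _ (wall Z n), h.wall_mul_bond]
    _ = 0 := by
        rw [hA, mul_assoc _ (wall Z n), ← mul_assoc (wall Z n), mul_sub, mul_one,
          (h.isStarProjection_wall n).isIdempotentElem.eq, sub_self, zero_mul, mul_zero, zero_mul]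

variable (htc : t ^ 2 + 4 * c ^ 2 = 1)
include htc

theorem isStarProjection_fixedProj_bondReflection (n : ℤ) :
    IsStarProjection (fixedProj (bondReflection t c Z X n)) := by
  have hX := (IsSelfAdjoint.commute_iff (h.star_X n) (h.star_X (n + 1))).1 (h.X_comm _ _)
  refine isStarProjection_fixedProj ?_ (h.bondReflection_mul_self htc n)
  simp [IsSelfAdjoint, bondReflection, (h.star_Z n).star_eq, hX.star_eq]

theorem isStarProjection_bond (n : ℤ) : IsStarProjection (bond t c Z X n) :=
  (h.isStarProjection_fixedProj_bondReflection htc n).mul (h.isStarProjection_wall n)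
    (commute_fixedProj (h.wall_commute_bondReflection n)).symm

theorem bond_mul_Z_mul_bond (n : ℤ) :
    bond t c Z X n * Z n * bond t c Z X n = (t : ℂ) • bond t c Z X n := by
  rw [eq_sub_of_add_eq (h.bond_mul_Z_add n), sub_mul, add_mul, smul_mul_assoc, mul_assoc,
    h.wall_mul_bond, mul_assoc, (h.isStarProjection_bond htc n).isIdempotentElem.eq,
    add_sub_cancel_left]

theorem bond_mul_Z_succ_mul_bond (n : ℤ) :
    bond t c Z X n * Z (n + 1) * bond t c Z X n = -((t : ℂ) • bond t c Z X n) := by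
  rw [← h.bond_mul_Z_mul_bond htc, ← h.wall_mul_bond, mul_assoc, ← mul_assoc (Z (n + 1)),
    h.Z_succ_mul_wall, neg_mul, mul_neg, mul_assoc (Z n), h.wall_mul_bond, mul_assoc]

theorem bond_mul_bond_succ_mul_bond (n : ℤ) :
    bond t c Z X n * bond t c Z X (n + 1) * bond t c Z X n = (c : ℂ) ^ 2 • bond t c Z X n := by
  have htc' : (t : ℂ) ^ 2 + 4 * (c : ℂ) ^ 2 = 1 := by exact_mod_cast htc
  have hZ := h.bond_mul_Z_succ_mul_bond htc n
  have hPZ : Commute (Z (n + 1 + 1)) (bond t c Z X n) :=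
    (h.bond_commute_Z (by omega) (by omega)).symm
  have hflip : bond t c Z X n * (X (n + 1) * X (n + 1 + 1) * wall Z (n + 1)) * bond t c Z X n =
      0 := by
    refine h.bond_mul_mul_bond_eq_zero ?_
    have hW : Commute (wall Z (n + 1)) (wall Z n) := commute_fixedProj
      ((h.Z_commute_wall _ _).symm.mul_right (h.Z_commute_wall _ _).symm).neg_right
    rw [mul_assoc, hW.eq, mul_assoc, ← mul_assoc (X (n + 1 + 1)),
      (h.X_commute_wall (by omega) (by omega)).eq, mul_assoc (wall Z n), ← mul_assoc,
      h.X_succ_mul_wall, mul_assoc, mul_assoc]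
  rw [h.bond_eq (n + 1)]
  set P := bond t c Z X n
  have hP : P * P = P := (h.isStarProjection_bond htc n).isIdempotentElem
  have hPZP : P * Z (n + 1 + 1) * P = P * Z (n + 1 + 1) := by
    rw [mul_assoc, hPZ.eq, ← mul_assoc, hP]
  have hPZZP : P * (Z (n + 1) * Z (n + 1 + 1)) * P = -((t : ℂ) • (P * Z (n + 1 + 1))) := by
    rw [← mul_assoc, mul_assoc, hPZ.eq, ← mul_assoc, hZ, neg_mul, smul_mul_assoc]
  simp only [mul_add, mul_sub, mul_smul_comm, add_mul, sub_mul, smul_mul_assoc, mul_one, hflip, hZ,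
    hP, hPZP, hPZZP]
  linear_combination (norm := module) (-1 / 4 : ℂ) • htc' • P

end Projections
end IsPauli

theorem chainSum_self {M : Type*} [AddCommMonoid M] (P : ℤ → M) (p : ℤ) : chainSum P p p = 0 := by
  simp [chainSum]

theorem chainSum_add_one {M : Type*} [AddCommMonoid M] (P : ℤ → M) {p q : ℤ} (hpq : p ≤ q) :
    chainSum P p (q + 1) = chainSum P p q + P q := by
  rw [chainSum, ← Finset.insert_Ico_right_eq_Ico_add_one hpq, Finset.sum_insert (by simp), add_comm,
    chainSum]

/-! ### Temperley–Lieb Hamiltonians -/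

section Hilbert

variable {H : Type*} [NormedAddCommGroup H] [InnerProductSpace ℂ H]

theorem le_re_inner_apply_of_le_norm_sq {T : H →L[ℂ] H} (hT : T.IsPositive) {γ : ℝ} (hγ : 0 ≤ γ)
    (h : ∀ v, γ * (⟪v, T v⟫_ℂ).re ≤ ‖T v‖ ^ 2) (v : H) :
    γ * ‖T v‖ ^ 2 ≤ (⟪T v, T (T v)⟫_ℂ).re := by
  have hpos := hT.re_inner_nonneg_right (T v - (γ : ℂ) • v)
  have hself : (⟪T v, T v⟫_ℂ).re = ‖T v‖ ^ 2 := inner_self_eq_norm_sq (𝕜 := ℂ) _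
  have hsymm : (⟪v, T (T v)⟫_ℂ).re = ‖T v‖ ^ 2 := by
    rw [← hself]
    exact congrArg Complex.re (hT.isSymmetric v (T v)).symm
  simp only [map_sub, map_smul, inner_sub_left, inner_sub_right, inner_smul_left, inner_smul_right,
    RCLike.re_eq_complex_re, Complex.sub_re, Complex.conj_ofReal, Complex.re_ofReal_mul, hsymm,
    hself] at hpos
  nlinarith [h v]

variable [CompleteSpace H]

theorem inner_apply_of_isStarProjection {P : H →L[ℂ] H} (hP : IsStarProjection P) (v w : H) :
    ⟪v, P w⟫_ℂ = ⟪P v, P w⟫_ℂ := by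
  have e : P (P w) = P w := congr($(hP.isIdempotentElem.eq) w)
  conv_lhs => rw [← e]
  exact (hP.isSelfAdjoint.isSymmetric v (P w)).symm

theorem re_inner_apply_of_isStarProjection {P : H →L[ℂ] H} (hP : IsStarProjection P) (v : H) :
    (⟪v, P v⟫_ℂ).re = ‖P v‖ ^ 2 := by
  rw [inner_apply_of_isStarProjection hP]
  exact inner_self_eq_norm_sq (𝕜 := ℂ) _

/-- The relations between projections which generate a Temperley–Lieb algebra. -/
structure IsTemperleyLieb (c : ℝ) (P : ℤ → H →L[ℂ] H) : Prop where
  isStarProjection : ∀ n, IsStarProjection (P n)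
  mul_mul : ∀ n, P n * P (n + 1) * P n = (c : ℂ) ^ 2 • P n
  commute : ∀ m n, m + 1 < n → Commute (P m) (P n)

theorem isPositive_chainSum {P : ℤ → H →L[ℂ] H} (hP : ∀ n, IsStarProjection (P n)) (p q : ℤ) :
    (chainSum P p q).IsPositive :=
  (ContinuousLinearMap.nonneg_iff_isPositive _).1 (Finset.sum_nonneg fun n _ => (hP n).nonneg)

namespace IsTemperleyLieb

variable {c : ℝ} {P : ℤ → H →L[ℂ] H} (h : IsTemperleyLieb c P) (hc : 0 ≤ c)
include h

theorem chainSum_commute {p q n : ℤ} (hn : q < n) : Commute (chainSum P p q) (P n) :=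
  .sum_left _ _ _ fun m hm => h.commute m n (by grind)

include hc

theorem norm_apply_succ_apply (n : ℤ) (v : H) : ‖P (n + 1) (P n v)‖ = c * ‖P n v‖ := by
  refine (sq_eq_sq₀ (norm_nonneg _) (by positivity)).1 ?_
  have hP := (h.isStarProjection n).isSelfAdjoint.isSymmetric v (P (n + 1) (P n v))
  have e : P n (P (n + 1) (P n v)) = (c : ℂ) ^ 2 • P n v := congr($(h.mul_mul n) v)
  simp only [ContinuousLinearMap.coe_coe, e, ← Complex.ofReal_pow, inner_smul_right] at hP
  rw [← re_inner_apply_of_isStarProjection (h.isStarProjection _), hP, Complex.re_ofReal_mul,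
    re_inner_apply_of_isStarProjection (h.isStarProjection _), mul_pow]

theorem neg_le_re_inner_apply_succ (n : ℤ) (v : H) :
    -(c * (‖P n v‖ ^ 2 + ‖P (n + 1) v‖ ^ 2)) ≤ 2 * (⟪P n v, P (n + 1) v⟫_ℂ).re := by
  have hle : ‖⟪P n v, P (n + 1) v⟫_ℂ‖ ≤ c * ‖P n v‖ * ‖P (n + 1) v‖ := by
    rw [inner_apply_of_isStarProjection (h.isStarProjection _), ← h.norm_apply_succ_apply hc]
    exact norm_inner_le_norm _ _
  have hre := (abs_le.1 ((Complex.abs_re_le_norm _).trans hle)).1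
  nlinarith [mul_nonneg hc (sq_nonneg (‖P n v‖ - ‖P (n + 1) v‖))]

theorem add_le_norm_sq_chainSum_succ {p q : ℤ} (hpq : p ≤ q) (v : H) :
    (1 - 2 * c) * (⟪v, chainSum P p (q + 1) v⟫_ℂ).re + c * ‖P q v‖ ^ 2 ≤
      ‖chainSum P p (q + 1) v‖ ^ 2 := by
  have hsq (n : ℤ) := re_inner_apply_of_isStarProjection (h.isStarProjection n) v
  induction q, hpq using Int.leInduction with
  | base =>
    rw [chainSum_add_one P le_rfl, chainSum_self, zero_add, hsq]
    nlinarith [mul_nonneg hc (sq_nonneg ‖P p v‖)]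
  | succ q hpq ih =>
    have hfar : 0 ≤ (⟪chainSum P p q v, P (q + 1) v⟫_ℂ).re := by
      have e : P (q + 1) (chainSum P p q v) = chainSum P p q (P (q + 1) v) :=
        congr($((h.chainSum_commute (p := p) (lt_add_one q)).eq.symm) v)
      rw [inner_apply_of_isStarProjection (h.isStarProjection (q + 1)), e]
      exact (isPositive_chainSum h.isStarProjection p q).re_inner_nonneg_left _
    have hnear := h.neg_le_re_inner_apply_succ hc q v
    have hcross : (⟪chainSum P p (q + 1) v, P (q + 1) v⟫_ℂ).re =
        (⟪chainSum P p q v, P (q + 1) v⟫_ℂ).re + (⟪P q v, P (q + 1) v⟫_ℂ).re := by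
      rw [chainSum_add_one P hpq, add_apply, inner_add_left, Complex.add_re]
    have hnorm := norm_add_sq (𝕜 := ℂ) (chainSum P p (q + 1) v) (P (q + 1) v)
    rw [RCLike.re_eq_complex_re, hcross] at hnorm
    rw [chainSum_add_one P (by omega), add_apply, hnorm, inner_add_right,
      Complex.add_re, hsq]
    linarith

theorem le_norm_sq_chainSum (p q : ℤ) (v : H) :
    (1 - 2 * c) * (⟪v, chainSum P p q v⟫_ℂ).re ≤ ‖chainSum P p q v‖ ^ 2 := by
  obtain hqp | hpq := le_or_gt q p
  · simp [chainSum, Finset.Ico_eq_empty_of_le hqp]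
  · obtain ⟨q, rfl⟩ : ∃ r, q = r + 1 := ⟨q - 1, by ring⟩
    exact (le_add_of_nonneg_right (by positivity)).trans
      (h.add_le_norm_sq_chainSum_succ hc (by omega) v)

end IsTemperleyLieb

end Hilbert

/-! ### Spin waves -/

theorem tendsto_add_one_sub_of_monotone {f : ℤ → ℝ} (hf : Monotone f)
    (hbdd : BddAbove (Set.range f)) : Tendsto (fun n => f (n + 1) - f n) atTop (𝓝 0) := by
  have hlim := tendsto_atTop_ciSup hf hbdd
  simpa only [sub_self, Function.comp_def, id_eq] using
    (hlim.comp (tendsto_atTop_add_const_right atTop (1 : ℤ) tendsto_id)).sub hlim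

theorem norm_apply_of_isSelfAdjoint_of_mul_self {H : Type*} [NormedAddCommGroup H]
    [InnerProductSpace ℂ H] [CompleteSpace H] {U : H →L[ℂ] H} (hU : IsSelfAdjoint U)
    (hU' : U * U = 1) (v : H) : ‖U v‖ = ‖v‖ := by
  have e : U (U v) = v := congr($hU' v)
  have hinner : ⟪U v, U v⟫_ℂ = ⟪v, v⟫_ℂ := (hU.isSymmetric v (U v)).trans congr(⟪v, $e⟫_ℂ)
  rw [norm_eq_sqrt_re_inner (𝕜 := ℂ), hinner, ← norm_eq_sqrt_re_inner]

/-- The failure of the spin flip at `n + 1` to hop freely. -/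
noncomputable def hoppingDefect {H : Type*} [NormedAddCommGroup H] [InnerProductSpace ℂ H]
    (t c : ℝ) (Z X : ℤ → H →L[ℂ] H) (Ω : H) (n : ℤ) : H :=
  (bond t c Z X n + bond t c Z X (n + 1)) (X (n + 1) Ω)
    - (X (n + 1) Ω - (c : ℂ) • X n Ω - (c : ℂ) • X (n + 1 + 1) Ω)

/-- The spin wave of momentum zero on the sites `m + 1, …, m + N`. -/
noncomputable def spinWave {R : Type*} [AddCommMonoid R] (X : ℤ → R) (m : ℤ) (N : ℕ) : R :=
  ∑ i ∈ Finset.range N, X (m + i + 1)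

theorem sum_range_hopping {R M : Type*} [CommRing R] [AddCommGroup M] [Module R M] (c : R)
    (f : ℤ → M) (m : ℤ) (N : ℕ) :
    ∑ i ∈ Finset.range N, (f (m + i + 1) - c • f (m + i) - c • f (m + i + 1 + 1)) =
      (1 - 2 * c) • ∑ i ∈ Finset.range N, f (m + i + 1)
        + c • (f (m + 1) - f m + (f (m + N) - f (m + N + 1))) := by
  induction N with
  | zero => simp
  | succ N ih =>
    rw [Finset.sum_range_succ, ih, Finset.sum_range_succ, Nat.cast_add_one, ← add_assoc m]
    module

theorem norm_chainSum_apply_le {H : Type*} [NormedAddCommGroup H] [InnerProductSpace ℂ H]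
    [CompleteSpace H] {P : ℤ → H →L[ℂ] H} (hP : ∀ n, IsStarProjection (P n)) (p q : ℤ) (v : H) :
    ‖chainSum P p q v‖ ≤ (q - p).toNat * ‖v‖ := by
  rw [chainSum, sum_apply]
  refine (norm_sum_le_of_le _ fun n _ =>
    (P n).le_of_opNorm_le (hP n).norm_le v).trans_eq ?_
  rw [one_mul, Finset.sum_const, Int.card_Ico, nsmul_eq_mul]

theorem sub_mul_norm_apply_le {H : Type*} [NormedAddCommGroup H] [InnerProductSpace ℂ H]
    {T : H →L[ℂ] H} {φ : H} {γ : ℝ} (h : γ * ‖T φ‖ ^ 2 ≤ (⟪T φ, T (T φ)⟫_ℂ).re) (e : ℝ) :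
    (γ - e) * ‖T φ‖ ≤ ‖T (T φ - (e : ℂ) • φ)‖ := by
  obtain h0 | hpos := (norm_nonneg (T φ)).eq_or_lt
  · rw [← h0, mul_zero]
    exact norm_nonneg _
  have hsplit : T (T φ) = (e : ℂ) • T φ + T (T φ - (e : ℂ) • φ) := by
    rw [map_sub, map_smul, add_sub_cancel]
  have hself : (⟪T φ, T φ⟫_ℂ).re = ‖T φ‖ ^ 2 := inner_self_eq_norm_sq (𝕜 := ℂ) _
  have hrest : (⟪T φ, T (T φ - (e : ℂ) • φ)⟫_ℂ).re ≤ ‖T φ‖ * ‖T (T φ - (e : ℂ) • φ)‖ :=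
    (Complex.re_le_norm _).trans (norm_inner_le_norm _ _)
  rw [hsplit, inner_add_right, inner_smul_right, Complex.add_re, Complex.re_ofReal_mul, hself] at h
  refine le_of_mul_le_mul_left ?_ hpos
  linarith

namespace IsPauli

variable {H : Type*} [NormedAddCommGroup H] [InnerProductSpace ℂ H] [CompleteSpace H]
  {Z X : ℤ → H →L[ℂ] H} (h : IsPauli Z X) {t c : ℝ} {Ω : H}

include h

theorem norm_X_apply (x : ℤ) (v : H) : ‖X x v‖ = ‖v‖ :=
  norm_apply_of_isSelfAdjoint_of_mul_self (h.star_X x) (h.X_sq x) v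

theorem norm_Z_apply (x : ℤ) (v : H) : ‖Z x v‖ = ‖v‖ :=
  norm_apply_of_isSelfAdjoint_of_mul_self (h.star_Z x) (h.Z_sq x) v

theorem isTemperleyLieb_bond (htc : t ^ 2 + 4 * c ^ 2 = 1) : IsTemperleyLieb c (bond t c Z X) where
  isStarProjection := h.isStarProjection_bond htc
  mul_mul := h.bond_mul_bond_succ_mul_bond htc
  commute _ _ := h.bond_commute_bond

theorem abs_re_inner_Z_le (n : ℤ) : |(⟪Ω, Z n Ω⟫_ℂ).re| ≤ ‖Ω‖ ^ 2 := by
  refine (Complex.abs_re_le_norm _).trans ((norm_inner_le_norm _ _).trans_eq ?_)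
  rw [h.norm_Z_apply, sq]

theorem norm_inner_X_X_le {x y : ℤ} (hxy : x < y) :
    ‖⟪X x Ω, X y Ω⟫_ℂ‖ ≤ 2 * ‖Ω‖ * ‖wall Z y Ω‖ := by
  set v := X x (X y Ω)
  have hv : ‖X x (X y (wall Z y Ω))‖ = ‖wall Z y Ω‖ := by rw [h.norm_X_apply, h.norm_X_apply]
  have e : v = X x (X y (wall Z y Ω)) + wall Z y v := by
    have e1 : X x * X y * wall Z y = X x * X y - wall Z y * (X x * X y) := by
      rw [mul_assoc, h.X_mul_wall, ← mul_assoc, mul_sub, mul_one,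
        (h.X_commute_wall (by omega) (by omega)).eq]
      noncomm_ring
    have e2 : X x (X y (wall Z y Ω)) = v - wall Z y v := congr($e1 Ω)
    rw [e2, sub_add_cancel]
  have hsymm : ⟪X x Ω, X y Ω⟫_ℂ = ⟪Ω, v⟫_ℂ := (h.star_X x).isSymmetric Ω (X y Ω)
  have hwall : ⟪Ω, wall Z y v⟫_ℂ = ⟪wall Z y Ω, v⟫_ℂ :=
    ((h.isStarProjection_wall y).isSelfAdjoint.isSymmetric Ω v).symm
  have hvΩ : ‖v‖ = ‖Ω‖ := by rw [h.norm_X_apply, h.norm_X_apply]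
  calc ‖⟪X x Ω, X y Ω⟫_ℂ‖ = ‖⟪Ω, X x (X y (wall Z y Ω))⟫_ℂ + ⟪wall Z y Ω, v⟫_ℂ‖ := by
        rw [hsymm, ← hwall, ← inner_add_right, ← e]
    _ ≤ ‖Ω‖ * ‖wall Z y Ω‖ + ‖wall Z y Ω‖ * ‖Ω‖ := by
        grw [norm_add_le, norm_inner_le_norm, norm_inner_le_norm, hv, hvΩ]
    _ = 2 * ‖Ω‖ * ‖wall Z y Ω‖ := by ring

section GroundVector

variable (hΩ : ∀ n, bond t c Z X n Ω = 0)
include hΩ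

theorem chainSum_bond_X_apply {p q n : ℤ} (hp : p ≤ n) (hq : n + 1 < q) :
    chainSum (bond t c Z X) p q (X (n + 1) Ω) =
      (bond t c Z X n + bond t c Z X (n + 1)) (X (n + 1) Ω) := by
  have hsub : ({n, n + 1} : Finset ℤ) ⊆ Finset.Ico p q := by grind
  have hfar : ∀ k ∈ Finset.Ico p q, k ∉ ({n, n + 1} : Finset ℤ) →
      bond t c Z X k (X (n + 1) Ω) = 0 := fun k _ hk => by
    have e : bond t c Z X k * X (n + 1) = X (n + 1) * bond t c Z X k :=
      h.bond_commute_X (by grind) (by grind)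
    exact congr($e Ω).trans (by rw [mul_apply_eq_comp, hΩ, map_zero])
  rw [chainSum, sum_apply, ← Finset.sum_subset hsub hfar,
    Finset.sum_pair (by omega), add_apply]

theorem chainSum_bond_spinWave_sub (m : ℤ) (N : ℕ) :
    chainSum (bond t c Z X) (m - 1) (m + N + 2) (spinWave X m N Ω)
        - ((1 - 2 * c : ℝ) : ℂ) • spinWave X m N Ω =
      ∑ i ∈ Finset.range N, hoppingDefect t c Z X Ω (m + i)
        + (c : ℂ) • (X (m + 1) Ω - X m Ω + (X (m + N) Ω - X (m + N + 1) Ω)) := by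
  have hwave : ∑ i ∈ Finset.range N, hoppingDefect t c Z X Ω (m + i) =
      chainSum (bond t c Z X) (m - 1) (m + N + 2) (spinWave X m N Ω) - ∑ i ∈ Finset.range N,
        (X (m + i + 1) Ω - (c : ℂ) • X (m + i) Ω - (c : ℂ) • X (m + i + 1 + 1) Ω) := by
    rw [spinWave, sum_apply, map_sum, ← Finset.sum_sub_distrib]
    refine Finset.sum_congr rfl fun i hi => ?_
    rw [hoppingDefect, h.chainSum_bond_X_apply hΩ (by omega) (by grind)]
  rw [hwave, sum_range_hopping (c : ℂ) (fun n => X n Ω), spinWave, sum_apply]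
  push_cast
  abel

theorem norm_chainSum_bond_spinWave_sub_le (hc : 0 ≤ c) (hΩ' : ‖Ω‖ = 1) (m : ℤ) (N : ℕ) :
    ‖chainSum (bond t c Z X) (m - 1) (m + N + 2) (spinWave X m N Ω)
        - ((1 - 2 * c : ℝ) : ℂ) • spinWave X m N Ω‖ ≤
      ∑ i ∈ Finset.range N, ‖hoppingDefect t c Z X Ω (m + i)‖ + 4 * c := by
  rw [h.chainSum_bond_spinWave_sub hΩ]
  grw [norm_add_le, norm_sum_le, norm_smul, norm_add_le, norm_sub_le, norm_sub_le]
  simp only [h.norm_X_apply, hΩ', Complex.norm_real, Real.norm_eq_abs, abs_of_nonneg hc]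
  linarith

variable (htc : t ^ 2 + 4 * c ^ 2 = 1)
include htc

theorem two_mul_mul_norm_sq_wall_apply (n : ℤ) :
    2 * t * ‖wall Z n Ω‖ ^ 2 = (⟪Ω, Z (n + 1) Ω⟫_ℂ).re - (⟪Ω, Z n Ω⟫_ℂ).re := by
  have hsymm : ⟪Ω, bond t c Z X n (Z n Ω)⟫_ℂ = 0 := by
    rw [inner_apply_of_isStarProjection (h.isStarProjection_bond htc n), hΩ, inner_zero_left]
  have e := congr((⟪Ω, $(h.bond_mul_Z_add (t := t) (c := c) n) Ω⟫_ℂ).re)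
  rw [h.Z_mul_wall] at e
  simp only [add_apply, mul_apply_eq_comp, hΩ, map_zero, add_zero, hsymm, smul_apply, sub_apply,
    inner_add_right, inner_sub_right, inner_smul_right, Complex.add_re, Complex.re_ofReal_mul,
    re_inner_apply_of_isStarProjection (h.isStarProjection_wall n), Complex.zero_re] at e
  norm_num at e
  linarith

theorem tendsto_wall_apply (ht : t ≠ 0) : Tendsto (fun n => wall Z n Ω) atTop (𝓝 0) := by
  set z : ℤ → ℝ := fun n => (⟪Ω, Z n Ω⟫_ℂ).re / (2 * t) with hz
  have hsq (n : ℤ) : ‖wall Z n Ω‖ ^ 2 = z (n + 1) - z n := by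
    rw [hz, ← sub_div, ← h.two_mul_mul_norm_sq_wall_apply hΩ htc]
    field_simp
  have hmono : Monotone z := monotone_int_of_le_succ fun n => by
    linarith [hsq n, sq_nonneg ‖wall Z n Ω‖]
  have hbdd : BddAbove (Set.range z) := by
    refine ⟨‖Ω‖ ^ 2 / |2 * t|, Set.forall_mem_range.2 fun n => (le_abs_self _).trans ?_⟩
    rw [abs_div]
    gcongr
    exact h.abs_re_inner_Z_le n
  have hlim := (tendsto_add_one_sub_of_monotone hmono hbdd).sqrt
  simp only [← hsq, Real.sqrt_sq (norm_nonneg _), Real.sqrt_zero] at hlim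
  exact tendsto_zero_iff_norm_tendsto_zero.2 hlim

theorem tendsto_inner_X_X (ht : t ≠ 0) (hΩ' : ‖Ω‖ = 1) (x y : ℤ) :
    Tendsto (fun m : ℤ => ⟪X (m + x) Ω, X (m + y) Ω⟫_ℂ) atTop (𝓝 (if x = y then 1 else 0)) := by
  wlog hxy : x ≤ y generalizing x y
  · simpa only [Function.comp_def, inner_conj_symm, eq_comm (a := y), apply_ite (starRingEnd ℂ),
      map_one, map_zero] using (Complex.continuous_conj.tendsto _).comp (this y x (by omega))
  obtain rfl | hlt := hxy.eq_or_lt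
  · simp [inner_self_eq_norm_sq_to_K, h.norm_X_apply, hΩ']
  · have hwall : Tendsto (fun m : ℤ => wall Z (m + y) Ω) atTop (𝓝 0) :=
      (h.tendsto_wall_apply hΩ htc ht).comp (tendsto_atTop_add_const_right _ _ tendsto_id)
    rw [if_neg hlt.ne]
    refine squeeze_zero_norm (fun m => h.norm_inner_X_X_le (by omega)) ?_
    simpa only [norm_zero, mul_zero] using hwall.norm.const_mul (2 * ‖Ω‖)

theorem tendsto_hoppingDefect (ht : t ≠ 0) : Tendsto (hoppingDefect t c Z X Ω) atTop (𝓝 0) := by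
  have hwall := h.tendsto_wall_apply hΩ htc ht
  have hwall' : Tendsto (fun n => wall Z (n + 1) Ω) atTop (𝓝 0) :=
    hwall.comp (tendsto_atTop_add_const_right _ _ tendsto_id)
  have hq (n : ℤ) (v : H) : ‖fixedProj (bondReflection t c Z X n) v‖ ≤ ‖v‖ :=
    ((fixedProj (bondReflection t c Z X n)).le_of_opNorm_le
      (h.isStarProjection_fixedProj_bondReflection htc n).norm_le v).trans_eq (one_mul _)
  refine squeeze_zero_norm (fun n => ?_) (a := fun n =>
    |t| * ‖wall Z n Ω‖ + ‖wall Z n Ω‖ + ‖wall Z (n + 1) Ω‖) ?_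
  · have e : hoppingDefect t c Z X Ω n = (t : ℂ) • X (n + 1) (Z n (wall Z n Ω))
        - fixedProj (bondReflection t c Z X n) (X (n + 1) (wall Z n Ω))
        - fixedProj (bondReflection t c Z X (n + 1)) (X (n + 1) (wall Z (n + 1) Ω)) := by
      have hcore := h.fixedProj_bondReflection_add_mul_X (t := t) (c := c) n
      rw [add_mul, ← sub_eq_iff_eq_add'] at hcore
      have hsum : (bond t c Z X n + bond t c Z X (n + 1)) * X (n + 1)
          - (X (n + 1) - (c : ℂ) • X n - (c : ℂ) • X (n + 1 + 1)) =
          (t : ℂ) • (X (n + 1) * (Z n * wall Z n))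
          - fixedProj (bondReflection t c Z X n) * X (n + 1) * wall Z n
          - fixedProj (bondReflection t c Z X (n + 1)) * X (n + 1) * wall Z (n + 1) := by
        rw [add_mul, h.bond_mul_X_succ, h.bond_mul_X, ← hcore]
        abel
      exact congr($hsum Ω)
    rw [e]
    grw [norm_sub_le, norm_sub_le, hq, hq]
    rw [norm_smul, Complex.norm_real, Real.norm_eq_abs, h.norm_X_apply, h.norm_X_apply,
      h.norm_X_apply, h.norm_Z_apply]
  · simpa only [norm_zero, mul_zero, add_zero] using
      ((hwall.norm.const_mul |t|).add hwall.norm).add hwall'.norm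

theorem norm_chainSum_bond_X_apply_le {p q n : ℤ} (hp : p ≤ n) (hq : n + 1 < q) :
    ‖chainSum (bond t c Z X) p q (X (n + 1) Ω)‖ ≤ 2 * ‖Ω‖ := by
  have hle (n : ℤ) (v : H) : ‖bond t c Z X n v‖ ≤ ‖v‖ :=
    ((bond t c Z X n).le_of_opNorm_le (h.isStarProjection_bond htc n).norm_le v).trans_eq
      (one_mul _)
  rw [h.chainSum_bond_X_apply hΩ hp hq, add_apply]
  grw [norm_add_le, hle, hle, h.norm_X_apply, two_mul]

theorem norm_chainSum_bond_apply_spinWave_sub_le (hc : 0 ≤ c) (hΩ' : ‖Ω‖ = 1) (m : ℤ) (N : ℕ) :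
    ‖chainSum (bond t c Z X) (m - 1) (m + N + 2)
        (chainSum (bond t c Z X) (m - 1) (m + N + 2) (spinWave X m N Ω)
          - ((1 - 2 * c : ℝ) : ℂ) • spinWave X m N Ω)‖ ≤
      (N + 3) * ∑ i ∈ Finset.range N, ‖hoppingDefect t c Z X Ω (m + i)‖ + 8 * c := by
  have hX (n : ℤ) (hp : m ≤ n) (hq : n ≤ m + N + 1) :
      ‖chainSum (bond t c Z X) (m - 1) (m + N + 2) (X n Ω)‖ ≤ 2 := by
    have := h.norm_chainSum_bond_X_apply_le hΩ htc (p := m - 1) (q := m + N + 2) (n := n - 1)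
      (by omega) (by omega)
    rwa [sub_add_cancel, hΩ', mul_one] at this
  rw [h.chainSum_bond_spinWave_sub hΩ, map_add, map_smul, map_add, map_sub, map_sub]
  have hlen : (m + N + 2 - (m - 1)).toNat = N + 3 := by omega
  grw [norm_add_le, norm_chainSum_apply_le (h.isStarProjection_bond htc), norm_sum_le, norm_smul,
    norm_add_le, norm_sub_le, norm_sub_le, hX _ (by omega) (by omega), hX _ (by omega) (by omega),
    hX _ (by omega) (by omega), hX _ (by omega) (by omega), hlen]
  simp only [Complex.norm_real, Real.norm_eq_abs, abs_of_nonneg hc]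
  push_cast
  linarith

variable (ht : t ≠ 0) (hΩ' : ‖Ω‖ = 1)
include ht hΩ'

theorem tendsto_norm_sq_spinWave (N : ℕ) :
    Tendsto (fun m => ‖spinWave X m N Ω‖ ^ 2) atTop (𝓝 N) := by
  have hinner (m : ℤ) : ‖spinWave X m N Ω‖ ^ 2 = (∑ i ∈ Finset.range N, ∑ j ∈ Finset.range N,
      ⟪X (m + (i + 1 : ℤ)) Ω, X (m + (j + 1 : ℤ)) Ω⟫_ℂ).re := by
    rw [← inner_self_eq_norm_sq (𝕜 := ℂ), spinWave, sum_apply, sum_inner]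
    simp only [inner_sum, add_assoc, RCLike.re_eq_complex_re]
  have hlim := (Complex.continuous_re.tendsto _).comp <| tendsto_finsetSum (Finset.range N)
    fun i _ => tendsto_finsetSum (Finset.range N) fun j _ =>
      h.tendsto_inner_X_X hΩ htc ht hΩ' (i + 1 : ℤ) (j + 1 : ℤ)
  have hsum : ∑ i ∈ Finset.range N, ∑ j ∈ Finset.range N,
      (if (i + 1 : ℤ) = j + 1 then 1 else 0 : ℂ) = N := by
    simp [Finset.sum_ite_mem, -Finset.mem_range]
  rw [hsum, Complex.natCast_re] at hlim
  simpa only [hinner, Function.comp_def] using hlim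

variable (hc : 0 ≤ c)
include hc

theorem exists_spinWave (N : ℕ) : ∃ m : ℤ,
    ‖chainSum (bond t c Z X) (m - 1) (m + N + 2) (spinWave X m N Ω)
        - ((1 - 2 * c : ℝ) : ℂ) • spinWave X m N Ω‖ ≤ 3 ∧
    ‖chainSum (bond t c Z X) (m - 1) (m + N + 2)
        (chainSum (bond t c Z X) (m - 1) (m + N + 2) (spinWave X m N Ω)
          - ((1 - 2 * c : ℝ) : ℂ) • spinWave X m N Ω)‖ ≤ 5 ∧
    N - 1 ≤ ‖spinWave X m N Ω‖ ^ 2 := by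
  have hdefect : Tendsto (fun m : ℤ => ∑ i ∈ Finset.range N, ‖hoppingDefect t c Z X Ω (m + i)‖)
      atTop (𝓝 0) := by
    simpa using tendsto_finsetSum (Finset.range N) fun i _ =>
      ((h.tendsto_hoppingDefect hΩ htc ht).comp
        (tendsto_atTop_add_const_right _ (i : ℤ) tendsto_id)).norm
  have hc' : c ≤ 1 / 2 := by nlinarith [sq_nonneg t]
  have hN : (0 : ℝ) < 1 / (N + 3) := by positivity
  obtain ⟨m, hm, hm'⟩ := ((hdefect.eventually (ge_mem_nhds hN)).and
    ((h.tendsto_norm_sq_spinWave hΩ htc ht hΩ' N).eventually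
      (le_mem_nhds (sub_one_lt (N : ℝ))))).exists
  rw [le_div_iff₀ (by positivity), mul_comm] at hm
  refine ⟨m, ?_, ?_, hm'⟩
  · grw [h.norm_chainSum_bond_spinWave_sub_le hΩ hc hΩ']
    nlinarith [Finset.sum_nonneg fun i (_ : i ∈ Finset.range N) =>
      norm_nonneg (hoppingDefect t c Z X Ω (m + i))]
  · grw [h.norm_chainSum_bond_apply_spinWave_sub_le hΩ htc hc hΩ']
    linarith

theorem le_of_forall_le_inner_spinWave {γ : ℝ}
    (hγ : ∀ (m : ℤ) (N : ℕ), γ * ‖chainSum (bond t c Z X) (m - 1) (m + N + 2)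
        (spinWave X m N Ω)‖ ^ 2 ≤
      (⟪chainSum (bond t c Z X) (m - 1) (m + N + 2) (spinWave X m N Ω),
        chainSum (bond t c Z X) (m - 1) (m + N + 2)
          (chainSum (bond t c Z X) (m - 1) (m + N + 2) (spinWave X m N Ω))⟫_ℂ).re) :
    γ ≤ 1 - 2 * c := by
  have he : 0 < 1 - 2 * c := by nlinarith [sq_pos_of_ne_zero ht]
  by_contra! hlt
  set B : ℝ := (5 / (γ - (1 - 2 * c)) + 3) / (1 - 2 * c)
  obtain ⟨N, hN⟩ := exists_nat_gt (B ^ 2 + 1)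
  obtain ⟨m, h1, h2, h3⟩ := h.exists_spinWave hΩ htc ht hΩ' hc N
  have henergy := (sub_mul_norm_apply_le (hγ m N) (1 - 2 * c)).trans h2
  set Φ := spinWave X m N Ω
  set TΦ := chainSum (bond t c Z X) (m - 1) (m + N + 2) Φ
  have hΦ : (1 - 2 * c) * ‖Φ‖ - 3 ≤ ‖TΦ‖ := by
    have := (norm_sub_norm_le (((1 - 2 * c : ℝ) : ℂ) • Φ) TΦ).trans (norm_sub_rev _ _).le
    rw [norm_smul, Complex.norm_real, Real.norm_of_nonneg he.le] at this
    linarith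
  have hB : ‖Φ‖ ≤ B := by
    rw [le_div_iff₀ he, ← sub_le_iff_le_add, le_div_iff₀ (sub_pos.2 hlt)]
    nlinarith
  nlinarith [norm_nonneg Φ]

end GroundVector
end IsPauli

/-! ### Local observables -/

section LocalHom

variable {Λ Λ' : Finset ℤ}

theorem overwrite_coe (τ : Λ → Fin 2) (σ : ℤ → Fin 2) (x : Λ) : overwrite τ σ x = τ x := by
  simp [overwrite]

theorem overwrite_of_notMem (τ : Λ → Fin 2) (σ : ℤ → Fin 2) {x : ℤ} (hx : x ∉ Λ) :
    overwrite τ σ x = σ x := by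
  simp [overwrite, hx]

theorem overwrite_overwrite (τ τ' : Λ → Fin 2) (σ : ℤ → Fin 2) :
    overwrite τ' (overwrite τ σ) = overwrite τ' σ := by
  funext x
  by_cases hx : x ∈ Λ <;> simp [overwrite, hx]

theorem overwrite_self (σ : ℤ → Fin 2) : overwrite (fun x : Λ => σ x) σ = σ := by
  funext x
  by_cases hx : x ∈ Λ <;> simp [overwrite, hx]

theorem overwrite_injective (σ : ℤ → Fin 2) :
    Function.Injective fun τ : Λ → Fin 2 => overwrite τ σ := fun τ τ' h => by
  funext x
  rw [← overwrite_coe τ σ x, ← overwrite_coe τ' σ x]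
  exact congrFun h x

theorem overwrite_comm (hΛ : Disjoint Λ Λ') (τ : Λ → Fin 2) (τ' : Λ' → Fin 2) (σ : ℤ → Fin 2) :
    overwrite τ (overwrite τ' σ) = overwrite τ' (overwrite τ σ) := by
  funext x
  by_cases hx : x ∈ Λ
  · simp [overwrite, hx, Finset.disjoint_left.1 hΛ hx]
  · by_cases hx' : x ∈ Λ' <;> simp [overwrite, hx, hx']

theorem matrixUnit_apply (ρ τ : Λ → Fin 2) (ψ : ConfigSpace) (σ : ℤ → Fin 2) :
    matrixUnit ρ τ ψ σ = if (fun x : Λ => σ x) = ρ then ψ (overwrite τ σ) else 0 := rfl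

theorem localOp_apply (A : LocalMatrix Λ) (ψ : ConfigSpace) (σ : ℤ → Fin 2) :
    localOp Λ A ψ σ = ∑ τ, A (fun x => σ x) τ * ψ (overwrite τ σ) := by
  simp only [localOp, sum_apply, smul_apply, lp.coeFn_sum, Finset.sum_apply, lp.coeFn_smul,
    Pi.smul_apply, smul_eq_mul, matrixUnit_apply]
  rw [Finset.sum_comm]
  simp

theorem star_matrixUnit (ρ τ : Λ → Fin 2) : star (matrixUnit ρ τ) = matrixUnit τ ρ := by
  rw [ContinuousLinearMap.star_eq_adjoint]
  refine ((ContinuousLinearMap.eq_adjoint_iff _ _).2 fun ψ φ => ?_).symm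
  -- The two inner products differ by the substitution which exchanges `ρ` and `τ` on `Λ`.
  have hinv : Function.Involutive fun σ : ℤ → Fin 2 =>
      overwrite (Equiv.swap ρ τ fun x : Λ => σ x) σ := fun σ => by
    simp only [overwrite_coe, overwrite_overwrite, Equiv.swap_apply_self, overwrite_self]
  rw [lp.inner_eq_tsum, lp.inner_eq_tsum, ← hinv.toPerm.tsum_eq]
  refine tsum_congr fun σ => ?_
  simp only [Function.Involutive.coe_toPerm, matrixUnit_apply, overwrite_coe, overwrite_overwrite]
  by_cases hσ : (fun x : Λ => σ x) = ρ
  · rw [if_pos hσ, hσ, Equiv.swap_apply_left, if_pos rfl, ← hσ, overwrite_self]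
  · rw [if_neg hσ, if_neg fun h => hσ (by simpa using congrArg (Equiv.swap ρ τ) h), inner_zero_left,
      inner_zero_right]

/-- The inclusion of the observables of `Λ` in the quasilocal algebra as a homomorphism. -/
noncomputable def localHom (Λ : Finset ℤ) : LocalMatrix Λ →⋆ₐ[ℂ] quasilocal where
  toFun := localObs Λ
  map_one' := by
    apply Subtype.ext
    ext ψ σ
    simp [localObs, localOp_apply, Matrix.one_apply, overwrite_self]
  map_mul' A B := by
    apply Subtype.ext
    ext ψ σ
    change localOp Λ (A * B) ψ σ = localOp Λ A (localOp Λ B ψ) σ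
    simp only [localOp_apply, overwrite_coe, overwrite_overwrite, Matrix.mul_apply, Finset.sum_mul,
      Finset.mul_sum, mul_assoc]
    exact Finset.sum_comm
  map_zero' := by
    apply Subtype.ext
    simp [localObs, localOp]
  map_add' A B := by
    apply Subtype.ext
    simp [localObs, localOp, add_smul, Finset.sum_add_distrib]
  commutes' r := by
    apply Subtype.ext
    ext ψ σ
    simp [localObs, localOp_apply, overwrite_self, Matrix.algebraMap_matrix_apply]
  map_star' A := by
    apply Subtype.ext
    change localOp Λ (star A) = star (localOp Λ A)
    simp only [localOp, Matrix.star_apply, star_sum, star_smul, star_matrixUnit]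
    exact Finset.sum_comm

theorem localHom_apply (A : LocalMatrix Λ) : localHom Λ A = localObs Λ A := rfl

theorem localHom_injective (Λ : Finset ℤ) : Function.Injective (localHom Λ) := fun A B hAB => by
  classical
  have entry (A : LocalMatrix Λ) (ρ τ : Λ → Fin 2) :
      localOp Λ A (lp.single 2 (overwrite τ 0) 1) (overwrite ρ 0) = A ρ τ := by
    rw [localOp_apply, Finset.sum_eq_single τ]
    · simp [overwrite_overwrite, overwrite_coe]
    · intro τ' _ hne
      simp [overwrite_overwrite, (overwrite_injective 0).ne hne]
    · simp
  ext ρ τ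
  rw [← entry A, ← entry B]
  exact congr($(congrArg Subtype.val hAB) _ _)

theorem localHom_extend (h : Λ ⊆ Λ') (A : LocalMatrix Λ) :
    localHom Λ' (extend h A) = localHom Λ A := by
  apply Subtype.ext
  ext ψ σ
  change localOp Λ' _ ψ σ = localOp Λ A ψ σ
  simp only [localOp_apply, extend, ite_mul, zero_mul]
  rw [← Finset.sum_filter]
  refine Finset.sum_nbij' (restrict h) (fun τ y => overwrite τ σ y) (by simp) ?_ ?_ ?_ ?_
  · intro τ _
    simpa using fun y _ hy => (overwrite_of_notMem τ σ hy).symm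
  · intro τ' hτ'
    simp only [Finset.mem_filter_univ] at hτ'
    funext y
    by_cases hy : (y : ℤ) ∈ Λ
    · simp [overwrite, hy, restrict]
    · simp [overwrite, hy, hτ' y hy]
  · intro τ _
    funext x
    exact overwrite_coe τ σ x
  · intro τ' hτ'
    simp only [Finset.mem_filter_univ] at hτ'
    refine congrArg₂ _ rfl (congrArg ψ ?_)
    funext y
    by_cases hy : y ∈ Λ
    · simp [overwrite, hy, h hy, restrict]
    · by_cases hy' : y ∈ Λ'
      · simp [overwrite, hy, hy', ← hτ' ⟨y, hy'⟩ hy]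
      · simp [overwrite, hy, hy']

theorem localHom_commute (hΛ : Disjoint Λ Λ') (A : LocalMatrix Λ) (B : LocalMatrix Λ') :
    Commute (localHom Λ A) (localHom Λ' B) := by
  apply Subtype.ext
  ext ψ σ
  change localOp Λ A (localOp Λ' B ψ) σ = localOp Λ' B (localOp Λ A ψ) σ
  have h1 (τ : Λ → Fin 2) : (fun x : Λ' => overwrite τ σ x) = fun x : Λ' => σ x :=
    funext fun x => overwrite_of_notMem τ σ (Finset.disjoint_right.1 hΛ x.2)
  have h2 (τ : Λ' → Fin 2) : (fun x : Λ => overwrite τ σ x) = fun x : Λ => σ x :=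
    funext fun x => overwrite_of_notMem τ σ (Finset.disjoint_left.1 hΛ x.2)
  simp only [localOp_apply, h1, h2, Finset.mul_sum, overwrite_comm hΛ]
  rw [Finset.sum_comm]
  exact Finset.sum_congr rfl fun _ _ => Finset.sum_congr rfl fun _ _ => mul_left_comm _ _ _

end LocalHom

section Sites

/-- The one-site observables at the site `x` as elements of the quasilocal algebra. -/
noncomputable def siteHom (x : ℤ) : Matrix (Fin 2) (Fin 2) ℂ →⋆ₐ[ℂ] quasilocal :=
  (localHom {x}).comp
    { (Matrix.reindexAlgEquiv ℂ ℂ (Equiv.funUnique ({x} : Finset ℤ) (Fin 2)).symm).toAlgHom with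
      map_star' := fun _ => rfl }

theorem localHom_atSite {Λ : Finset ℤ} (x : Λ) (M : Matrix (Fin 2) (Fin 2) ℂ) :
    localHom Λ (atSite x M) = siteHom x M := by
  rw [siteHom, StarAlgHom.comp_apply, ← localHom_extend (Finset.singleton_subset_iff.2 x.2)]
  congr 1
  ext ρ τ
  simp only [atSite, extend, Finset.mem_singleton, Subtype.coe_inj]
  rfl

theorem siteHom_commute {x y : ℤ} (hxy : x ≠ y) (M N : Matrix (Fin 2) (Fin 2) ℂ) :
    Commute (siteHom x M) (siteHom y N) :=
  localHom_commute (by simpa using hxy) _ _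

/-- The Pauli matrix `σ³`. -/
noncomputable def pauliZ : Matrix (Fin 2) (Fin 2) ℂ := !![1, 0; 0, -1]

/-- The Pauli matrix `σ¹`. -/
noncomputable def pauliX : Matrix (Fin 2) (Fin 2) ℂ := !![0, 1; 1, 0]

/-- The Pauli matrix `σ³` at the site `x` as a quasilocal observable. -/
noncomputable def obsZ (x : ℤ) : quasilocal := siteHom x pauliZ

/-- The Pauli matrix `σ¹` at the site `x` as a quasilocal observable. -/
noncomputable def obsX (x : ℤ) : quasilocal := siteHom x pauliX

theorem isPauli_obs : IsPauli obsZ obsX where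
  Z_sq x := by
    rw [obsZ, ← map_mul, ← map_one (siteHom x)]
    simp [pauliZ, Matrix.one_fin_two]
  X_sq x := by
    rw [obsX, ← map_mul, ← map_one (siteHom x)]
    simp [pauliX, Matrix.one_fin_two]
  anticomm x := by
    rw [obsX, obsZ, ← map_mul, ← map_mul, ← map_neg]
    simp [pauliX, pauliZ]
  Z_comm x y := by
    obtain rfl | hxy := eq_or_ne x y
    exacts [Commute.refl _, siteHom_commute hxy _ _]
  X_comm x y := by
    obtain rfl | hxy := eq_or_ne x y
    exacts [Commute.refl _, siteHom_commute hxy _ _]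
  X_Z_comm _ _ hxy := siteHom_commute hxy _ _
  star_Z x := by
    rw [IsSelfAdjoint, obsZ, ← map_star]
    congr 1
    ext i j
    fin_cases i <;> fin_cases j <;> simp [pauliZ]
  star_X x := by
    rw [IsSelfAdjoint, obsX, ← map_star]
    congr 1
    ext i j
    fin_cases i <;> fin_cases j <;> simp [pauliX]

theorem localHom_atSite_S1 {Λ : Finset ℤ} (x : Λ) :
    localHom Λ (atSite x S1) = (1 / 2 : ℂ) • obsX x := by
  have hS : S1 = (1 / 2 : ℂ) • pauliX := by simp [S1, pauliX]
  rw [localHom_atSite, hS, map_smul, obsX]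

theorem localHom_atSite_S2 {Λ : Finset ℤ} (x : Λ) :
    localHom Λ (atSite x S2) = (Complex.I / 2) • (obsX x * obsZ x) := by
  have hS : S2 = (Complex.I / 2) • (pauliX * pauliZ) := by simp [S2, pauliX, pauliZ, neg_div]
  rw [localHom_atSite, hS, map_smul, map_mul, obsX, obsZ]

theorem localHom_atSite_S3 {Λ : Finset ℤ} (x : Λ) :
    localHom Λ (atSite x S3) = (1 / 2 : ℂ) • obsZ x := by
  have hS : S3 = (1 / 2 : ℂ) • pauliZ := by simp [S3, pauliZ, neg_div]
  rw [localHom_atSite, hS, map_smul, obsZ]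

/-- The projection `h(n, n + 1) + 1/4` as a quasilocal observable. -/
noncomputable def kinkBond (ξ : ℝ) (n : ℤ) : quasilocal :=
  bond (Real.tanh ξ) (1 / (2 * Real.cosh ξ)) obsZ obsX n

theorem tanh_sq_add (ξ : ℝ) : Real.tanh ξ ^ 2 + 4 * (1 / (2 * Real.cosh ξ)) ^ 2 = 1 := by
  have := (Real.cosh_pos ξ).ne'
  rw [Real.tanh_eq_sinh_div_cosh]
  field_simp
  linarith [Real.cosh_sq ξ]

end Sites

section Bonds

variable (ξ : ℝ) {Λ : Finset ℤ} {x y : Λ}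

/-- The interaction of `x` and `y`, shifted by a constant to have ground state energy zero. -/
noncomputable def bondMatrix (x y : Λ) : LocalMatrix Λ := interaction ξ x y + (1 / 4 : ℂ) • 1

variable (hxy : (y : ℤ) = x + 1)
include hxy

theorem localHom_bondMatrix : localHom Λ (bondMatrix ξ x y) = kinkBond ξ x := by
  have hS2 : obsX x * obsZ x * (obsX y * obsZ y) = obsX x * obsX y * (obsZ x * obsZ y) :=
    (isPauli_obs.X_Z_comm y x (by omega)).symm.mul_mul_mul_comm _ _
  have hI : Complex.I / 2 * (Complex.I / 2) = -(1 / 4) := by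
    linear_combination Complex.I_mul_I / 4
  have hc : ((1 / Real.cosh ξ : ℝ) : ℂ) = 2 * ((1 / (2 * Real.cosh ξ) : ℝ) : ℂ) := by
    have := (Real.cosh_pos ξ).ne'
    norm_cast
    field_simp
  rw [kinkBond, isPauli_obs.bond_eq, wall, fixedProj, ← hxy]
  simp only [bondMatrix, interaction, map_add, map_sub, map_smul, map_mul, map_one,
    localHom_atSite_S1, localHom_atSite_S2, localHom_atSite_S3, Complex.ofReal_sub, hc,
    smul_mul_smul_comm, hS2, hI]
  simp only [mul_smul_comm, mul_add, mul_one, mul_neg]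
  push_cast
  module

theorem isStarProjection_bondMatrix : IsStarProjection (bondMatrix ξ x y) := by
  have h : IsStarProjection (localHom Λ (bondMatrix ξ x y)) := by
    rw [localHom_bondMatrix ξ hxy]
    exact isPauli_obs.isStarProjection_bond (tanh_sq_add ξ) x
  refine ⟨localHom_injective Λ ?_, localHom_injective Λ ?_⟩
  · rw [map_mul, h.isIdempotentElem.eq]
  · rw [map_star, h.isSelfAdjoint.star_eq]

open Matrix in
theorem bondMatrix_mulVec_single : bondMatrix ξ x y *ᵥ Pi.single 0 1 = 0 := by
  have hup (z : Λ) : atSite z pauliZ *ᵥ Pi.single 0 1 = Pi.single 0 1 := by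
    ext ρ
    have hρ : ρ = 0 ↔ (∀ y, y ≠ z → ρ y = 0) ∧ ρ z = 0 :=
      ⟨fun h => by simp [h], fun h => funext fun y => (eq_or_ne y z).elim (· ▸ h.2) (h.1 y)⟩
    simp only [mulVec_single_one, col_apply, atSite, Pi.single_apply, Pi.zero_apply, hρ, ite_and]
    refine if_congr Iff.rfl ?_ rfl
    generalize ρ z = b
    fin_cases b <;> simp [pauliZ]
  have hwall : bondMatrix ξ x y * fixedProj (-(atSite x pauliZ * atSite y pauliZ)) =
      bondMatrix ξ x y := by
    refine localHom_injective Λ ?_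
    have := isPauli_obs.bond_mul_wall (t := Real.tanh ξ) (c := 1 / (2 * Real.cosh ξ)) x
    rw [wall, ← hxy, ← kinkBond] at this
    rw [map_mul, localHom_bondMatrix ξ hxy]
    simpa only [fixedProj, map_smul, map_add, map_one, map_neg, map_mul, localHom_atSite]
  rw [← hwall, ← mulVec_mulVec, fixedProj, smul_mulVec, add_mulVec, neg_mulVec, ← mulVec_mulVec,
    hup, hup, one_mulVec, add_neg_cancel, smul_zero, mulVec_zero]

end Bonds

/-! ### Finite volumes -/

section Frustration

theorem apply_eq_zero_of_forall_le_re_inner {H ι : Type*} [NormedAddCommGroup H]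
    [InnerProductSpace ℂ H] [CompleteSpace H] [Fintype ι] {P : ι → H →L[ℂ] H}
    (hP : ∀ i, IsStarProjection (P i)) {e ψ : H} (he : e ≠ 0) (hPe : ∀ i, P i e = 0) {κ E : ℝ}
    (hψ : (∑ i, P i - (κ : ℂ) • 1) ψ = (E : ℂ) • ψ)
    (hE : ∀ φ, E * ‖φ‖ ^ 2 ≤ (⟪φ, (∑ i, P i - (κ : ℂ) • 1) φ⟫_ℂ).re) (i : ι) : P i ψ = 0 := by
  have energy (φ : H) : (⟪φ, (∑ i, P i - (κ : ℂ) • 1) φ⟫_ℂ).re =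
      ∑ i, ‖P i φ‖ ^ 2 - κ * ‖φ‖ ^ 2 := by
    simp only [sub_apply, sum_apply, smul_apply, one_apply_eq_self, inner_sub_right, inner_sum,
      inner_smul_right, Complex.sub_re, Complex.re_sum, Complex.re_ofReal_mul,
      re_inner_apply_of_isStarProjection (hP _)]
    congr 2
    exact inner_self_eq_norm_sq (𝕜 := ℂ) φ
  have hEκ : E + κ ≤ 0 := by
    have := hE e
    simp only [energy, hPe, norm_zero, ne_eq, OfNat.ofNat_ne_zero, not_false_eq_true, zero_pow,
      Finset.sum_const_zero] at this
    have hpos : 0 < ‖e‖ ^ 2 := by positivity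
    nlinarith
  have hsum : ∑ i, ‖P i ψ‖ ^ 2 = (E + κ) * ‖ψ‖ ^ 2 := by
    have := energy ψ
    rw [hψ, inner_smul_right, Complex.re_ofReal_mul] at this
    have hself : (⟪ψ, ψ⟫_ℂ).re = ‖ψ‖ ^ 2 := inner_self_eq_norm_sq (𝕜 := ℂ) ψ
    rw [hself] at this
    linarith
  have hzero : ∑ i, ‖P i ψ‖ ^ 2 = 0 :=
    le_antisymm (hsum.trans_le (mul_nonpos_of_nonpos_of_nonneg hEκ (sq_nonneg _)))
      (Finset.sum_nonneg fun _ _ => sq_nonneg _)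
  simpa using (Finset.sum_eq_zero_iff_of_nonneg fun _ _ => sq_nonneg _).1 hzero i
    (Finset.mem_univ i)

theorem hamiltonian_eq (ξ : ℝ) (Λ : Finset ℤ) : ∃ κ : ℝ, hamiltonian ξ Λ =
    (∑ x : Λ, if hx : (x : ℤ) + 1 ∈ Λ then bondMatrix ξ x ⟨(x : ℤ) + 1, hx⟩ else 0)
      - (κ : ℂ) • 1 := by
  refine ⟨∑ x : Λ, if (x : ℤ) + 1 ∈ Λ then 1 / 4 else 0, ?_⟩
  rw [hamiltonian, Complex.ofReal_sum, Finset.sum_smul, ← Finset.sum_sub_distrib]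
  refine Finset.sum_congr rfl fun x _ => ?_
  split_ifs <;> simp [bondMatrix]

theorem IsGroundVector.bondMatrix_apply_eq_zero {ξ : ℝ} {Λ : Finset ℤ} {ψ : LocalSpace Λ}
    (hψ : IsGroundVector ξ Λ ψ) {x y : Λ} (hxy : (y : ℤ) = x + 1) :
    Matrix.toEuclideanLin (bondMatrix ξ x y) ψ = 0 := by
  let T := Matrix.toEuclideanCLM (n := Λ → Fin 2) (𝕜 := ℂ)
  obtain ⟨-, E, (hE : T (hamiltonian ξ Λ) ψ = _),
    (hmin : ∀ φ, _ ≤ (⟪φ, T (hamiltonian ξ Λ) φ⟫_ℂ).re)⟩ := hψ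
  obtain ⟨κ, hκ⟩ := hamiltonian_eq ξ Λ
  set P : Λ → LocalMatrix Λ := fun x =>
    if hx : (x : ℤ) + 1 ∈ Λ then bondMatrix ξ x ⟨(x : ℤ) + 1, hx⟩ else 0 with hP
  have hH : T (hamiltonian ξ Λ) = ∑ x, T (P x) - (κ : ℂ) • 1 := by
    rw [hκ, map_sub, map_sum, map_smul, map_one]
  have hproj (x : Λ) : IsStarProjection (T (P x)) := by
    by_cases hx : (x : ℤ) + 1 ∈ Λ
    · simpa only [hP, hx, dif_pos] using (isStarProjection_bondMatrix ξ rfl).map T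
    · simp [hP, hx]
  have hup (x : Λ) : T (P x) (EuclideanSpace.single 0 1) = 0 := by
    by_cases hx : (x : ℤ) + 1 ∈ Λ
    · simp only [hP, hx, dif_pos]
      exact congrArg (WithLp.toLp 2) (bondMatrix_mulVec_single ξ rfl)
    · simp [hP, hx]
  have hy : (x : ℤ) + 1 ∈ Λ := hxy ▸ y.2
  obtain rfl : y = ⟨(x : ℤ) + 1, hy⟩ := Subtype.ext hxy
  have hPψ := apply_eq_zero_of_forall_le_re_inner hproj (by simp) hup (hH ▸ hE) (hH ▸ hmin) x
  simp only [hP, hy, dif_pos] at hPψ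
  exact hPψ

theorem IsGroundVector.expectation_bondMatrix {ξ : ℝ} {V Λ : Finset ℤ} {ψ : LocalSpace V}
    (hψ : IsGroundVector ξ V ψ) (hΛ : Λ ⊆ V) {x y : Λ} (hxy : (y : ℤ) = x + 1) :
    expectation ψ (bondMatrix ξ x y) = 0 := by
  have hext : extend hΛ (bondMatrix ξ x y) = bondMatrix ξ ⟨x, hΛ x.2⟩ ⟨y, hΛ y.2⟩ :=
    localHom_injective V <| (localHom_extend hΛ _).trans <|
      (localHom_bondMatrix ξ hxy).trans
        (localHom_bondMatrix ξ (x := ⟨x, hΛ x.2⟩) (y := ⟨y, hΛ y.2⟩) hxy).symm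
  rw [expectation, dif_pos hΛ, hext, hψ.bondMatrix_apply_eq_zero hxy, inner_zero_right]

end Frustration

section Derivation

theorem lie_sum_sub_smul_one {R ι : Type*} [Ring R] [Algebra ℂ R] {P : ι → R} {s t : Finset ι}
    (hst : s ⊆ t) {A : R} (hA : ∀ n ∉ s, Commute (P n) A) (κ : ℂ) :
    ⁅∑ n ∈ t, P n - κ • 1, A⁆ = ⁅∑ n ∈ s, P n, A⁆ := by
  simp only [Ring.lie_def, sub_mul, mul_sub, smul_mul_assoc, mul_smul_comm, one_mul, mul_one,
    sub_sub_sub_cancel_right, Finset.sum_mul, Finset.mul_sum, ← Finset.sum_sub_distrib]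
  exact (Finset.sum_subset hst fun n _ hn => sub_eq_zero.2 (hA n hn).eq).symm

variable (ξ : ℝ)

theorem exists_localHom_hamiltonian (Λ : Finset ℤ) : ∃ κ : ℂ,
    localHom Λ (hamiltonian ξ Λ) = ∑ n ∈ Λ with n + 1 ∈ Λ, kinkBond ξ n - κ • 1 := by
  obtain ⟨κ, hκ⟩ := hamiltonian_eq ξ Λ
  have hbond (x : Λ) : localHom Λ (if hx : (x : ℤ) + 1 ∈ Λ then
      bondMatrix ξ x ⟨(x : ℤ) + 1, hx⟩ else 0) = if (x : ℤ) + 1 ∈ Λ then kinkBond ξ x else 0 := by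
    split_ifs
    exacts [localHom_bondMatrix ξ rfl, map_zero _]
  refine ⟨κ, ?_⟩
  simp only [hκ, map_sub, map_sum, map_smul, map_one, hbond]
  rw [Finset.sum_coe_sort Λ fun n => if n + 1 ∈ Λ then kinkBond ξ n else 0, Finset.sum_filter]

theorem exists_localHom_bondMatrix_eq_kinkBond (n : ℤ) : ∃ x y : Finset.Icc n (n + 1),
    (y : ℤ) = x + 1 ∧ localHom (Finset.Icc n (n + 1)) (bondMatrix ξ x y) = kinkBond ξ n :=
  ⟨⟨n, by simp⟩, ⟨n + 1, by simp⟩, rfl, localHom_bondMatrix ξ rfl⟩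

theorem kinkBond_commute_localHom {Λ : Finset ℤ} {n : ℤ} (h : n ∉ Λ) (h' : n + 1 ∉ Λ)
    (A : LocalMatrix Λ) : Commute (kinkBond ξ n) (localHom Λ A) := by
  obtain ⟨x, y, -, hxy⟩ := exists_localHom_bondMatrix_eq_kinkBond ξ n
  rw [← hxy]
  refine localHom_commute (Finset.disjoint_left.2 fun z hz hzΛ => ?_) _ _
  obtain rfl | rfl : z = n ∨ z = n + 1 := by
    rw [Finset.mem_Icc] at hz
    omega
  exacts [h hzΛ, h' hzΛ]

theorem derivation_eq {p q : ℤ} {A : quasilocal}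
    (hA : ∀ n ∉ Finset.Ico p q, Commute (kinkBond ξ n) A) :
    derivation ξ A = ⁅chainSum (kinkBond ξ) p q, A⁆ := by
  refine Tendsto.limUnder_eq (tendsto_const_nhds.congr' ?_)
  filter_upwards [eventually_ge_atTop (Finset.Icc p q)] with Λ hΛ
  obtain ⟨κ, hκ⟩ := exists_localHom_hamiltonian ξ Λ
  have hsub : Finset.Ico p q ⊆ {n ∈ Λ | n + 1 ∈ Λ} := fun n hn => by
    rw [Finset.mem_Ico] at hn
    exact Finset.mem_filter.2
      ⟨hΛ (Finset.mem_Icc.2 (by omega)), hΛ (Finset.mem_Icc.2 (by omega))⟩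
  rw [← localHom_apply, hκ]
  exact (lie_sum_sub_smul_one hsub hA κ).symm

variable {Λ : Finset ℤ} {p q : ℤ}

theorem derivation_localObs (hΛ : Λ ⊆ Finset.Ioo p q) (A : LocalMatrix Λ) :
    derivation ξ (localObs Λ A) = ⁅chainSum (kinkBond ξ) p q, localObs Λ A⁆ := by
  refine derivation_eq ξ fun n hn => kinkBond_commute_localHom ξ ?_ ?_ A <;>
  · intro h
    have := Finset.mem_Ioo.1 (hΛ h)
    rw [Finset.mem_Ico] at hn
    omega

theorem derivation_derivation_localObs (hΛ : Λ ⊆ Finset.Ioo (p + 1) (q - 1))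
    (A : LocalMatrix Λ) : derivation ξ (derivation ξ (localObs Λ A)) =
      ⁅chainSum (kinkBond ξ) p q, ⁅chainSum (kinkBond ξ) p q, localObs Λ A⁆⁆ := by
  have hΛ' : Λ ⊆ Finset.Ioo p q := hΛ.trans (Finset.Ioo_subset_Ioo (by omega) (by omega))
  rw [← derivation_localObs ξ hΛ']
  refine derivation_eq ξ fun n hn => ?_
  rw [Finset.mem_Ico] at hn
  have hnΛ {x : ℤ} (hx : x = n ∨ x = n + 1) : x ∉ Λ := fun h => by
    have := Finset.mem_Ioo.1 (hΛ h)
    omega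
  have hA : Commute (kinkBond ξ n) (localObs Λ A) :=
    kinkBond_commute_localHom ξ (hnΛ (.inl rfl)) (hnΛ (.inr rfl)) A
  have hH : Commute (kinkBond ξ n) (chainSum (kinkBond ξ) (p + 1) (q - 1)) :=
    Commute.sum_right _ _ _ fun m hm => by
      rw [Finset.mem_Ico] at hm
      obtain h | h : m + 1 < n ∨ n + 1 < m := by omega
      exacts [(isPauli_obs.bond_commute_bond h).symm, isPauli_obs.bond_commute_bond h]
  rw [derivation_localObs ξ hΛ, Ring.lie_def]
  exact (hH.mul_right hA).sub_right (hA.mul_right hH)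

end Derivation

/-! ### Ground states and the gap -/

section Gap

theorem exists_gns.{u} {A : Type u} [CStarAlgebra A] (ω : A →ₗ[ℂ] ℂ)
    (hω : ∀ a, 0 ≤ ω (star a * a)) :
    ∃ (H : Type u) (_ : NormedAddCommGroup H) (_ : InnerProductSpace ℂ H) (_ : CompleteSpace H)
      (π : A →⋆ₐ[ℂ] H →L[ℂ] H) (Ω : H), ∀ a, ω a = ⟪Ω, π a Ω⟫_ℂ := by
  let := CStarAlgebra.spectralOrder A
  have := CStarAlgebra.spectralOrderedRing A
  let f : A →ₚ[ℂ] ℂ := PositiveLinearMap.mk₀ ω fun a ha => by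
    obtain ⟨b, rfl⟩ := CStarAlgebra.nonneg_iff_eq_star_mul_self.1 ha
    exact hω b
  refine ⟨f.GNS, inferInstance, inferInstance, inferInstance, f.gnsStarAlgHom,
    (f.toPreGNS 1 : f.GNS), fun a => ?_⟩
  have hπ : f.gnsStarAlgHom a (f.toPreGNS 1 : f.GNS) = (f.toPreGNS a : f.GNS) := by
    simp [PositiveLinearMap.gnsStarAlgHom, PositiveLinearMap.gnsNonUnitalStarAlgHom_apply_coe]
  rw [hπ, UniformSpace.Completion.inner_coe, PositiveLinearMap.preGNS_inner_def,
    PositiveLinearMap.ofPreGNS_toPreGNS, PositiveLinearMap.ofPreGNS_toPreGNS, star_one, one_mul]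
  rfl

theorem inner_self_eq_ofReal {H : Type*} [NormedAddCommGroup H] [InnerProductSpace ℂ H] (v : H) :
    ⟪v, v⟫_ℂ = ((‖v‖ ^ 2 : ℝ) : ℂ) := by
  exact_mod_cast inner_self_eq_norm_sq_to_K v

theorem ofReal_mul_inner_self_le_inner_iff {H : Type*} [NormedAddCommGroup H]
    [InnerProductSpace ℂ H] {T : H →L[ℂ] H} (hT : T.IsPositive) (γ : ℝ) (v : H) :
    (γ : ℂ) * ⟪v, v⟫_ℂ ≤ ⟪v, T v⟫_ℂ ↔ γ * ‖v‖ ^ 2 ≤ (⟪v, T v⟫_ℂ).re := by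
  have hreal : ((⟪v, T v⟫_ℂ).re : ℂ) = ⟪v, T v⟫_ℂ :=
    (Complex.eq_re_of_ofReal_le (r := 0) (by simpa using hT.inner_nonneg_right v)).symm
  rw [← hreal, inner_self_eq_ofReal, Complex.ofReal_re, ← Complex.ofReal_mul, Complex.real_le_real]

theorem exists_subset_Ioo (Λ : Finset ℤ) : ∃ p q, Λ ⊆ Finset.Ioo p q := by
  obtain ⟨p, hp⟩ := Λ.bddBelow
  obtain ⟨q, hq⟩ := Λ.bddAbove
  exact ⟨p - 1, q + 1, fun x hx =>
    Finset.mem_Ioo.2 ⟨by have := hp hx; omega, by have := hq hx; omega⟩⟩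

theorem exists_localHom_eq_spinWave (m : ℤ) (N : ℕ) :
    ∃ A, localHom (Finset.Ioo m (m + N + 1)) A = spinWave obsX m N :=
  have hX (i : ℕ) (hi : i ∈ Finset.range N) :
      obsX (m + i + 1) ∈ (localHom (Finset.Ioo m (m + N + 1))).range :=
    ⟨atSite ⟨m + i + 1, by rw [Finset.mem_range] at hi; rw [Finset.mem_Ioo]; omega⟩ pauliX,
      localHom_atSite _ _⟩
  sum_mem hX

theorem two_mul_half_sech (ξ : ℝ) : 2 * (1 / (2 * Real.cosh ξ)) = 1 / Real.cosh ξ := by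
  have := (Real.cosh_pos ξ).ne'
  field_simp

variable {ξ : ℝ} {ω : quasilocal →ₗ[ℂ] ℂ} {H : Type*} [NormedAddCommGroup H]
  [InnerProductSpace ℂ H] [CompleteSpace H] {π : quasilocal →⋆ₐ[ℂ] H →L[ℂ] H} {Ω : H}

variable (π)

theorem map_kinkBond (n : ℤ) : π (kinkBond ξ n) = bond (Real.tanh ξ) (1 / (2 * Real.cosh ξ))
    (fun x => π (obsZ x)) (fun x => π (obsX x)) n :=
  map_bond (π : quasilocal →ₐ[ℂ] H →L[ℂ] H) n

theorem isTemperleyLieb_map_kinkBond :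
    IsTemperleyLieb (1 / (2 * Real.cosh ξ)) fun n => π (kinkBond ξ n) := by
  simp only [map_kinkBond]
  exact (isPauli_obs.map π).isTemperleyLieb_bond (tanh_sq_add ξ)

variable {π}

theorem apply_star_mul (hω : ∀ A, ω A = ⟪Ω, π A Ω⟫_ℂ) (A B : quasilocal) :
    ω (star A * B) = ⟪π A Ω, π B Ω⟫_ℂ := by
  rw [hω, map_mul, map_star, ContinuousLinearMap.star_eq_adjoint, mul_apply_eq_comp,
    ContinuousLinearMap.adjoint_inner_right]

theorem map_lie_chainSum_apply (hΩ : ∀ n, π (kinkBond ξ n) Ω = 0) (p q : ℤ) (A : quasilocal) :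
    π ⁅chainSum (kinkBond ξ) p q, A⁆ Ω = chainSum (fun n => π (kinkBond ξ n)) p q (π A Ω) := by
  simp [Ring.lie_def, chainSum, hΩ]

theorem isGroundState_of_map_kinkBond_eq_zero (hω : IsState ω) (hπ : ∀ A, ω A = ⟪Ω, π A Ω⟫_ℂ)
    (hΩ : ∀ n, π (kinkBond ξ n) Ω = 0) : IsGroundState ξ ω := by
  refine ⟨hω, fun Λ A => ?_⟩
  obtain ⟨p, q, hΛ⟩ := exists_subset_Ioo Λ
  rw [derivation_localObs ξ hΛ, apply_star_mul hπ, map_lie_chainSum_apply hΩ]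
  exact (isPositive_chainSum
    (isTemperleyLieb_map_kinkBond π).isStarProjection p q).inner_nonneg_right _

theorem mul_apply_derivation_le_iff (hπ : ∀ A, ω A = ⟪Ω, π A Ω⟫_ℂ)
    (hΩ : ∀ n, π (kinkBond ξ n) Ω = 0) (γ : ℝ) {Λ : Finset ℤ} {p q : ℤ}
    (hΛ : Λ ⊆ Finset.Ioo (p + 1) (q - 1)) (A : LocalMatrix Λ) :
    γ * ω (star (derivation ξ (localObs Λ A)) * derivation ξ (localObs Λ A)) ≤
        ω (star (derivation ξ (localObs Λ A)) * derivation ξ (derivation ξ (localObs Λ A))) ↔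
      γ * ‖chainSum (fun n => π (kinkBond ξ n)) p q (π (localObs Λ A) Ω)‖ ^ 2 ≤
        (⟪chainSum (fun n => π (kinkBond ξ n)) p q (π (localObs Λ A) Ω),
          chainSum (fun n => π (kinkBond ξ n)) p q
            (chainSum (fun n => π (kinkBond ξ n)) p q (π (localObs Λ A) Ω))⟫_ℂ).re := by
  rw [derivation_derivation_localObs ξ hΛ,
    derivation_localObs ξ (p := p) (q := q)
      (hΛ.trans (Finset.Ioo_subset_Ioo (by omega) (by omega)))]
  simp only [apply_star_mul hπ, map_lie_chainSum_apply hΩ]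
  exact ofReal_mul_inner_self_le_inner_iff
    (isPositive_chainSum (isTemperleyLieb_map_kinkBond π).isStarProjection p q) _ _

theorem one_sub_mem_gapBounds (hπ : ∀ A, ω A = ⟪Ω, π A Ω⟫_ℂ)
    (hΩ : ∀ n, π (kinkBond ξ n) Ω = 0) : 1 - 1 / Real.cosh ξ ∈ gapBounds ξ ω := by
  intro Λ A
  obtain ⟨p, q, hΛ⟩ := exists_subset_Ioo Λ
  rw [mul_apply_derivation_le_iff (p := p - 1) (q := q + 1) hπ hΩ _ (by simpa using hΛ)]
  have hTL := isTemperleyLieb_map_kinkBond (ξ := ξ) π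
  refine le_re_inner_apply_of_le_norm_sq (isPositive_chainSum hTL.isStarProjection _ _) ?_
    (fun v => ?_) _
  · exact sub_nonneg.2 ((div_le_one (Real.cosh_pos ξ)).2 (Real.one_le_cosh ξ))
  · rw [← two_mul_half_sech]
    exact hTL.le_norm_sq_chainSum (by positivity) _ _ v

theorem le_of_mem_gapBounds (hξ : ξ ≠ 0) (hω : ω 1 = 1) (hπ : ∀ A, ω A = ⟪Ω, π A Ω⟫_ℂ)
    (hΩ : ∀ n, π (kinkBond ξ n) Ω = 0) {γ : ℝ} (hγ : γ ∈ gapBounds ξ ω) :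
    γ ≤ 1 - 1 / Real.cosh ξ := by
  have hΩ' : ‖Ω‖ = 1 := by
    have h := hπ 1
    rw [hω, map_one, one_apply_eq_self, inner_self_eq_ofReal] at h
    exact (pow_eq_one_iff_of_nonneg (norm_nonneg Ω) two_ne_zero).1 (Complex.ofReal_eq_one.1 h.symm)
  have ht : Real.tanh ξ ≠ 0 := fun h => hξ (Real.tanh_injective (h.trans Real.tanh_zero.symm))
  rw [← two_mul_half_sech]
  refine (isPauli_obs.map π).le_of_forall_le_inner_spinWave (fun n => ?_) (tanh_sq_add ξ) ht hΩ'
    (by positivity) fun m N => ?_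
  · rw [← map_kinkBond, hΩ]
  · obtain ⟨A, hA⟩ := exists_localHom_eq_spinWave m N
    have hΦ : π (localObs _ A) Ω = spinWave (fun x => π (obsX x)) m N Ω := by
      rw [← localHom_apply, hA, spinWave, map_sum, spinWave]
    have hbounds := (mul_apply_derivation_le_iff (p := m - 1) (q := m + N + 2) hπ hΩ γ
      (Finset.Ioo_subset_Ioo (by omega) (by omega)) A).1 (hγ _ A)
    simpa only [map_kinkBond, hΦ] using hbounds

theorem IsState.isGroundState_and_isSpectralGap (hξ : ξ ≠ 0) (hω : IsState ω)
    (hbond : ∀ n, ω (kinkBond ξ n) = 0) :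
    IsGroundState ξ ω ∧ IsSpectralGap ξ ω (1 - 1 / Real.cosh ξ) := by
  have : IsClosed (quasilocal : Set (ConfigSpace →L[ℂ] ConfigSpace)) :=
    StarSubalgebra.isClosed_topologicalClosure _
  obtain ⟨H, _, _, _, π, Ω, hπ⟩ := exists_gns ω hω.1
  have hΩ (n : ℤ) : π (kinkBond ξ n) Ω = 0 := by
    have h := re_inner_apply_of_isStarProjection
      ((isTemperleyLieb_map_kinkBond (ξ := ξ) π).isStarProjection n) Ω
    rw [← hπ, hbond] at h
    simpa using h.symm
  exact ⟨isGroundState_of_map_kinkBond_eq_zero hω hπ hΩ, one_sub_mem_gapBounds hπ hΩ,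
    fun γ hγ => le_of_mem_gapBounds hξ hω.2 hπ hΩ hγ⟩

end Gap

section Limit

variable {ξ : ℝ} {ω : quasilocal →ₗ[ℂ] ℂ} {ι : Type*} {l : Filter ι} [l.NeBot] {V : ι → Finset ℤ}
  {ψ : ∀ i, LocalSpace (V i)}

theorem IsWeakStarLimit.apply_kinkBond (hlim : IsWeakStarLimit l V ψ ω) (hV : Tendsto V l atTop)
    (hψ : ∀ i, IsGroundVector ξ (V i) (ψ i)) (n : ℤ) : ω (kinkBond ξ n) = 0 := by
  obtain ⟨x, y, hxy, hbond⟩ := exists_localHom_bondMatrix_eq_kinkBond ξ n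
  rw [← hbond]
  refine tendsto_nhds_unique (hlim _ (bondMatrix ξ x y)) (tendsto_const_nhds.congr' ?_)
  filter_upwards [hV.eventually_ge_atTop (Finset.Icc n (n + 1))] with i hi
  exact ((hψ i).expectation_bondMatrix hi hxy).symm

end Limit
end XXZ

theorem proposition3p1_general (ξ : ℝ) (hξ : ξ ≠ 0)
    {ι : Type*} (l : Filter ι) [l.NeBot] (V : ι → Finset ℤ)
    (hV : Filter.Tendsto V l Filter.atTop) (ψ : ∀ i, XXZ.LocalSpace (V i))
    (hψ : ∀ i, XXZ.IsGroundVector ξ (V i) (ψ i))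
    (ω : XXZ.quasilocal →ₗ[ℂ] ℂ) (hω : XXZ.IsState ω) (hlim : XXZ.IsWeakStarLimit l V ψ ω) :
    XXZ.IsGroundState ξ ω ∧ XXZ.IsSpectralGap ξ ω (1 - 1 / Real.cosh ξ) :=
  hω.isGroundState_and_isSpectralGap hξ (hlim.apply_kinkBond hV hψ)

theorem proposition3p1 (ξ : ℝ) (hξ : 0 < ξ)
    {ι : Type*} (l : Filter ι) [l.NeBot] (a b : ι → ℤ)
    (ha : Filter.Tendsto a l Filter.atBot) (hb : Filter.Tendsto b l Filter.atTop)
    (ψ : ∀ i, XXZ.LocalSpace (Finset.Icc (a i) (b i)))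
    (hψ : ∀ i, XXZ.IsGroundVector ξ (Finset.Icc (a i) (b i)) (ψ i))
    (ω : XXZ.quasilocal →ₗ[ℂ] ℂ) (hω : XXZ.IsState ω)
    (hlim : XXZ.IsWeakStarLimit l (fun i => Finset.Icc (a i) (b i)) ψ ω) :
    XXZ.IsGroundState ξ ω ∧ XXZ.IsSpectralGap ξ ω (1 - 1 / Real.cosh ξ) :=
  proposition3p1_general ξ hξ.ne' l _
    (Finset.tendsto_Icc_atBot_prod_atTop.comp (ha.prodMk hb)) ψ hψ ω hω hlim
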